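/- **Data and Riemann–Hilbert problem.** Let $r:\mathbb R\to\mathbb C$ satisfy $\overline{r(k)}=r(-k)$, and let $k_1,\dots,k_N$ be distinct points with $\operatorname{Im}k_j>0$ and $\gamma_1,\dots,\gamma_N\in\mathbb C$, such that for every $j$ there is $j'$ with $k_{j'}=-\overline{k_j}$ and $\gamma_{j'}=\overline{\gamma_j}$. For real $\hat x,t$ let $\sigma_3=\operatorname{diag}(1,-1)$, $\hat Q=\bigl(\mathrm i k\hat x+\frac{t}{4\mathrm i k}\bigr)\sigma_3$ and $$J(\hat x,t,k)=\mathrm e^{-\hat Q}\begin{pmatrix}1+|r(k)|^2&\overline{r(k)}\\ r(k)&1\end{pmatrix}\mathrm e^{\hat Q},\qquad k\in\mathbb R\setminus\{0\}.$$ A solution of the RH problem at $(\hat x,t)$ is a $2\times2$ matrix function $\hat M(k)$, $k\in\mathbb C\setminus\mathbb R$, whose first column $\hat M^{(1)}$ is holomorphic except for at most simple poles at the $k_j$, whose second column $\hat M^{(2)}$ is holomorphic except for at most simple poles at the $\overline{k_j}$, such that $$\operatorname*{Res}_{k=k_j}\hat M^{(1)}=\mathrm i\gamma_j\mathrm e^{2\mathrm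 i(k_j\hat x-\frac{t}{4k_j})}\hat M^{(2)}(k_j),\qquad \operatorname*{Res}_{k=\overline{k_j}}\hat M^{(2)}=\mathrm i\overline{\gamma_j}\,\mathrm e^{-2\mathrm i(\overline{k_j}\hat x-\frac{t}{4\overline{k_j}})}\hat M^{(1)}(\overline{k_j}),$$ the limits $\hat M_\pm(k)$ from $\pm\operatorname{Im}k>0$ exist at every real point, $\hat M_+=\hat M_-J$ on $\mathbb R\setminus\{0\}$, and $\hat M(k)\to I$ as $k\to\infty$, $k\notin\mathbb R$. **Assumptions.** Let $\mathcal T\subset\mathbb R$ be open (for example $(0,\infty)$ or $\mathbb R$), and suppose that for all $\hat x\in\mathbb R$, $t\in\mathcal T$ the RH problem has a unique solution $\hat M(\hat x,t,\cdot)$. Assume that the limits (all for $k\notin\mathbb R$) $$\hat M(\hat x,t,k)\to I,\qquad k\bigl(\hat M(\hat x,t,k)-I\bigr)\to \text{some } M_1(\hat x,t)\qquad(k\to\infty),$$ $$\hat M(\hat x,t,k)\to\hat M(\hat x,t,0),\qquad \tfrac{\mathrm i}{k}\bigl(\hat M^{-1}(\hat x,t,0)\hat M(\hat x,t,k)-I\bigr)\to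 G_1(\hat x,t)\qquad(k\to0)$$ exist locally uniformly in $(\hat x,t)\in\mathbb R\times\mathcal T$. **Conclusion, part 1.** There are real functions $\alpha,\beta,f_1,f_2$ on $\mathbb R\times\mathcal T$ with $$\hat M(\hat x,t,0)=\begin{pmatrix}\alpha&\beta\\-\beta&\alpha\end{pmatrix},\qquad G_1=\begin{pmatrix}f_1&f_2\\f_2&-f_1\end{pmatrix}.$$ Put $x(\hat x,t)=\hat x+f_1(\hat x,t)$, $\hat u(\hat x,t)=f_2(\hat x,t)$ and $\hat q(\hat x,t)=\dfrac1{\alpha^2(\hat x,t)-\beta^2(\hat x,t)}$. Let $\Omega\subset\mathbb R\times\mathcal T$ be an open set on which $\alpha^2-\beta^2>0$ and on which $(\hat x,t)\mapsto(x(\hat x,t),t)$ is injective (for example $\Omega=\mathbb R\times\mathcal T$, if $\hat q$ is everywhere finite and positive and $\hat x\mapsto x(\hat x,t)$ is a bijection for each $t\in\mathcal T$). Let $\Omega'$ be the image of $\Omega$ under this map, write $(x,t)\mapsto(\hat x(x,t),t)$ for the inverse map $\Omega'\to\Omega$, and set $$u(x,t)=\hat u(\hat x(x,t),t),\qquad q(x,t)=\hat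 q(\hat x(x,t),t).$$ **Conclusion, part 2.** The set $\Omega'$ is open; at every point of $\Omega'$ the derivatives $u_x,q_x,q_t$ exist, and $$q=\sqrt{1+u_x^2},\qquad q_t=\tfrac12\,(u^2q)_x .$$ That is, $u$ solves the short pulse equation in conservation-law form on $\Omega'$. -/

import Mathlib

open Filter Topology Matrix

noncomputable section

namespace ShortPulse

/-- Complex `2 × 2` matrices. -/
abbrev Mat := Matrix (Fin 2) (Fin 2) ℂ

/-- The data of the Riemann-Hilbert problem: a function `r` on the real line and finitely many
distinct points `k j` of the upper half-plane with constants `γ j`, subject to the reality symmetry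
`k ↦ -conj k` that the scattering data of a real potential have. -/
structure SpectralData where
  r : ℝ → ℂ
  N : ℕ
  k : Fin N → ℂ
  γ : Fin N → ℂ
  r_symm : ∀ s : ℝ, star (r s) = r (-s)
  k_im_pos : ∀ j, 0 < (k j).im
  k_injective : Function.Injective k
  k_symm : ∀ j, ∃ j', k j' = -star (k j) ∧ γ j' = star (γ j)

/-- The complex plane without the contour `ℝ`. -/
def offReal : Set ℂ := {z | z.im ≠ 0}

/-- The scalar phase `i k x + t / (4 i k)`; the matrix phase is this number times `σ₃`. -/
def phase (x t : ℝ) (k : ℂ) : ℂ := Complex.I * k * x + t / (4 * Complex.I * k)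

/-- The matrix `exp (c σ₃)`. -/
def expSigma3 (c : ℂ) : Mat := !![Complex.exp c, 0; 0, Complex.exp (-c)]

namespace SpectralData

variable (D : SpectralData)

/-- The undressed jump matrix. -/
def J0 (s : ℝ) : Mat :=
  !![1 + (‖D.r s‖ : ℂ) ^ 2, star (D.r s); D.r s, 1]

/-- The jump matrix `exp (-Q) J₀ exp Q`, `Q = phase · σ₃`, at the point `s` of the contour. -/
def J (x t s : ℝ) : Mat :=
  expSigma3 (-phase x t s) * D.J0 s * expSigma3 (phase x t s)

/-- `M` solves the Riemann-Hilbert problem with data `D` and parameters `x`, `t`.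
Values of `M` on the real line, of its first column at the points `k j`, and of its second column
at the points `conj (k j)` play no role. -/
structure IsRHSolution (x t : ℝ) (M : ℂ → Mat) : Prop where
  /-- The first column is holomorphic off the real line and the points `k j`. -/
  holo_fst : ∀ i, DifferentiableOn ℂ (fun z => M z i 0) (offReal \ Set.range D.k)
  /-- The second column is holomorphic off the real line and the points `conj (k j)`. -/
  holo_snd : ∀ i, DifferentiableOn ℂ (fun z => M z i 1)
    (offReal \ Set.range (fun j => star (D.k j)))
  /-- At `k j` the first column has at most a simple pole, with the prescribed residue. -/
  res_fst : ∀ j i, Tendsto (fun z => (z - D.k j) * M z i 0) (𝓝[≠] (D.k j))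
    (𝓝 (Complex.I * D.γ j * Complex.exp (2 * Complex.I * (D.k j * x - t / (4 * D.k j)))
      * M (D.k j) i 1))
  /-- At `conj (k j)` the second column has at most a simple pole, with the prescribed residue. -/
  res_snd : ∀ j i, Tendsto (fun z => (z - star (D.k j)) * M z i 1) (𝓝[≠] (star (D.k j)))
    (𝓝 (Complex.I * star (D.γ j) *
      Complex.exp (-2 * Complex.I * (star (D.k j) * x - t / (4 * star (D.k j))))
      * M (star (D.k j)) i 0))
  /-- Limits from above and from below exist at each real point, and are related by the jump
  matrix (at each point where the latter is defined, that is, off the origin). -/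
  jump : ∃ Mp Mm : ℝ → Mat, ∀ s : ℝ,
    Tendsto M (𝓝[{z | 0 < z.im}] (s : ℂ)) (𝓝 (Mp s)) ∧
    Tendsto M (𝓝[{z | z.im < 0}] (s : ℂ)) (𝓝 (Mm s)) ∧
    (s ≠ 0 → Mp s = Mm s * D.J x t s)
  /-- Normalization at infinity. -/
  norm_infty : Tendsto M (cocompact ℂ ⊓ 𝓟 offReal) (𝓝 1)

/-- For all `x` and all `t ∈ I`, the function `M x t` is the unique solution of the
Riemann-Hilbert problem (unique as a function off the real line and the poles). -/
def IsUniqueRHFamily (I : Set ℝ) (M : ℝ → ℝ → ℂ → Mat) : Prop :=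
  ∀ x : ℝ, ∀ t ∈ I, D.IsRHSolution x t (M x t) ∧
    ∀ M' : ℂ → Mat, D.IsRHSolution x t M' →
      Set.EqOn M' (M x t) (offReal \ (Set.range D.k ∪ Set.range (fun j => star (D.k j))))

end SpectralData

/-- The value `M(0)`, as the limit of `M(k)` for `k → 0` off the contour. -/
def atZero (M : ℂ → Mat) : Mat := limUnder (𝓝[offReal] 0) M

/-- The limit of `(i / k) (M(0)⁻¹ M(k) - 1)` for `k → 0` off the contour. -/
def slopeAtZero (M : ℂ → Mat) : Mat :=
  limUnder (𝓝[offReal] 0) (fun k => (Complex.I / k) • ((atZero M)⁻¹ * M k - 1))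

/-- The first order expansions of `M x t k` for `k → ∞` and for `k → 0` exist, locally uniformly
in the parameters `x ∈ ℝ`, `t ∈ I`. -/
structure HasExpansions (I : Set ℝ) (M : ℝ → ℝ → ℂ → Mat) : Prop where
  infty_zeroth : TendstoLocallyUniformlyOn (fun (k : ℂ) (p : ℝ × ℝ) => M p.1 p.2 k)
    (fun _ => 1) (cocompact ℂ ⊓ 𝓟 offReal) (Set.univ ×ˢ I)
  infty_first : ∃ M₁ : ℝ × ℝ → Mat,
    TendstoLocallyUniformlyOn (fun (k : ℂ) (p : ℝ × ℝ) => k • (M p.1 p.2 k - 1))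
      M₁ (cocompact ℂ ⊓ 𝓟 offReal) (Set.univ ×ˢ I)
  zero_zeroth : TendstoLocallyUniformlyOn (fun (k : ℂ) (p : ℝ × ℝ) => M p.1 p.2 k)
    (fun p => atZero (M p.1 p.2)) (𝓝[offReal] 0) (Set.univ ×ˢ I)
  zero_first : TendstoLocallyUniformlyOn
    (fun (k : ℂ) (p : ℝ × ℝ) =>
      (Complex.I / k) • ((atZero (M p.1 p.2))⁻¹ * M p.1 p.2 k - 1))
    (fun p => slopeAtZero (M p.1 p.2)) (𝓝[offReal] 0) (Set.univ ×ˢ I)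

section Profiles

variable (M : ℝ → ℝ → ℂ → Mat) (y t : ℝ)

/-- The real functions `α`, `β` with `M(0) = (α β; -β α)`. -/
def alpha : ℝ := (atZero (M y t) 0 0).re

/-- See `alpha`. -/
def beta : ℝ := (atZero (M y t) 0 1).re

/-- The real functions `f₁`, `f₂` with `lim (i / k) (M(0)⁻¹ M(k) - 1) = (f₁ f₂; f₂ -f₁)`. -/
def f1 : ℝ := (slopeAtZero (M y t) 0 0).re

/-- See `f1`. -/
def f2 : ℝ := (slopeAtZero (M y t) 0 1).re

/-- The change of variables `x(y, t) = y + f₁(y, t)`. -/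
def xOf : ℝ := y + f1 M y t

/-- `û = f₂`. -/
def uHat : ℝ := f2 M y t

/-- `q̂ = 1 / (α² - β²)`. -/
def qHat : ℝ := 1 / (alpha M y t ^ 2 - beta M y t ^ 2)

end Profiles

end ShortPulse

end

/-! Nothing is assumed about differentiability in the parameters, so the Lax pair cannot be obtained
by differentiating the Riemann-Hilbert problem. It is extracted from comparing solutions at
different parameters. For solutions `M'`, `M` with phases `Q'`, `Q`, the quotient E = M' exp(-(Q' -
Q)) adj M (`transfer`) has no jump, because the phases undo the conjugation of `J0` and det J0 = 1.
It has no poles either, because the residue conditions cancel in its entries. With equal times it is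
entire in k (`exists_entire_of_eq_time`); with equal space variables it is entire in ζ = 1/k
(`exists_entire_of_eq_space`). The real axis is removed by Painlevé's theorem.

Let δ be the parameter difference. On the circle |w| = 1 the point w/δ tends to infinity as δ → 0,
while the exponential in E(w/δ) depends on w alone. The expansions of the solutions therefore give
the limit of E(w/δ) on the circle, the maximum principle carries it into the disk, and evaluation at
w = δz gives the limit of E(z). This is `tendsto_of_tendsto_offRealInfty`; its first order version
`tendsto_inv_smul_sub_one` differentiates E in the parameter, with a commutator as the constant
term. The zeroth order gives det M = 1 and joint continuity in the parameters, the first order gives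
both Lax equations.

Write A for M(0) and N for A⁻¹M. Uniqueness transfers the symmetries of the data to M, which gives A
and G₁ their real forms and makes the first coefficient at infinity traceless. Taking k → 0 in the
Lax equations for N, and reading those for A directly, yields ∂f₁/∂x̂ = α² - β² - 1, ∂f₂/∂x̂ = 2αβ,
∂f₁/∂t = -f₂²/2, α_t = -βf₂/2, β_t = αf₂/2, with α² + β² = 1. Hence ∂x/∂x̂ = 1/q̂ and ∂x/∂t = -û²/2.
The formula for q is (α² - β²)² + (2αβ)² = 1, and the conservation law is (α² - β²)_t =
-∂(f₂²/2)/∂x̂ in the new coordinates; `shortPulse_of_profiles` performs the change of variables with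
the inverse function theorem. -/

namespace ShortPulse

/-! ### Removing the real line and finitely many points -/

open Complex Metric in
/-- **Painlevé's theorem** on a disk centred on the real line. -/
theorem differentiableOn_ball_of_continuousOn_of_offReal {F : Type*} [NormedAddCommGroup F]
    [NormedSpace ℂ F] [CompleteSpace F] {f : ℂ → F} {c : ℂ} {r : ℝ} (hc : c.im = 0)
    (hf : ContinuousOn f (ball c r)) (hd : DifferentiableOn ℂ f (ball c r ∩ offReal)) :
    DifferentiableOn ℂ f (ball c r) := by
  refine (isConservativeOn_and_continuousOn_iff_isDifferentiableOn isOpen_ball).1 ⟨?_, hf⟩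
  intro z w hzw
  -- The centre is real, so moving vertically towards the axis stays in the disk.
  have hshrink : ∀ x y y' : ℝ, (⟨x, y⟩ : ℂ) ∈ ball c r → |y'| ≤ |y| → (⟨x, y'⟩ : ℂ) ∈ ball c r := by
    intro x y y' h hy
    rw [mem_ball, dist_eq_re_im] at h ⊢
    refine lt_of_le_of_lt (Real.sqrt_le_sqrt ?_) h
    simp only [hc, sub_zero]
    have := sq_le_sq.2 hy
    linarith
  have habs : ∀ a y : ℝ, y ∈ Set.uIcc a 0 → |y| ≤ |a| := by
    intro a y hy
    simpa using Set.abs_sub_right_of_mem_uIcc hy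
  -- Cauchy-Goursat for a rectangle with one side on the real axis: its interior misses the axis,
  -- and continuity suffices on the boundary. A general rectangle is the difference of two of these,
  -- so Morera's theorem applies.
  have key : ∀ a b d : ℝ, (∀ x ∈ Set.uIcc a b, (⟨x, d⟩ : ℂ) ∈ ball c r) →
      (((∫ x : ℝ in a..b, f (x + d * I)) - ∫ x : ℝ in a..b, f (x + (0 : ℝ) * I)) +
        I • ∫ y : ℝ in d..0, f (b + y * I)) - I • ∫ y : ℝ in d..0, f (a + y * I) = 0 := by
    intro a b d hab
    have hsub : Set.uIcc a b ×ℂ Set.uIcc d 0 ⊆ ball c r := by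
      intro p hp
      exact hshrink p.re d p.im (hab _ hp.1) (habs _ _ hp.2)
    have := integral_boundary_rect_eq_zero_of_continuousOn_of_differentiableOn f ⟨a, d⟩ ⟨b, 0⟩
      (hf.mono hsub) ?_
    · exact this
    · refine hd.mono fun p hp => ⟨hsub ?_, ?_⟩
      · exact ⟨⟨hp.1.1.le, hp.1.2.le⟩, ⟨hp.2.1.le, hp.2.2.le⟩⟩
      · rcases le_total d 0 with h | h
        · have := hp.2.2
          simp only [h, max_eq_right] at this
          exact this.ne
        · have := hp.2.1
          simp only [h, min_eq_right] at this
          exact this.ne'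
  have hmem : ∀ x ∈ Set.uIcc z.re w.re, ∀ y ∈ Set.uIcc z.im w.im, (⟨x, y⟩ : ℂ) ∈ ball c r :=
    fun x hx y hy => hzw ⟨hx, hy⟩
  have h1 := key z.re w.re z.im fun x hx => hmem x hx _ Set.left_mem_uIcc
  have h2 := key z.re w.re w.im fun x hx => hmem x hx _ Set.right_mem_uIcc
  have hint : ∀ x ∈ Set.uIcc z.re w.re, ∀ d ∈ Set.uIcc z.im w.im,
      IntervalIntegrable (fun y : ℝ => f (x + y * I)) MeasureTheory.volume d 0 := by
    intro x hx d hd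
    refine ContinuousOn.intervalIntegrable ?_
    refine hf.comp (by fun_prop) fun y hy => ?_
    have : ((x : ℂ) + y * I) = ⟨x, y⟩ := by
      apply Complex.ext <;> simp
    rw [this]
    exact hshrink _ _ _ (hmem x hx d hd) (habs _ _ hy)
  rw [eq_neg_iff_add_eq_zero, wedgeIntegral_add_wedgeIntegral_eq,
    ← intervalIntegral.integral_add_adjacent_intervals
      (hint w.re Set.right_mem_uIcc z.im Set.left_mem_uIcc)
      (hint w.re Set.right_mem_uIcc w.im Set.right_mem_uIcc).symm,
    ← intervalIntegral.integral_add_adjacent_intervals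
      (hint z.re Set.left_mem_uIcc z.im Set.left_mem_uIcc)
      (hint z.re Set.left_mem_uIcc w.im Set.right_mem_uIcc).symm,
    intervalIntegral.integral_symm w.im 0, intervalIntegral.integral_symm w.im 0]
  rw [← sub_eq_zero.2 (h1.trans h2.symm)]
  simp only [smul_add, smul_neg]
  abel

theorem isOpen_offReal : IsOpen offReal :=
  isOpen_ne_fun Complex.continuous_im continuous_const

theorem dense_offReal : Dense offReal := by
  intro z
  rw [Metric.mem_closure_iff]
  intro ε hε
  by_cases hz : z.im = 0
  · refine ⟨z + (ε / 2 : ℝ) * Complex.I, ?_, ?_⟩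
    · simp [offReal, hz, hε.ne']
    · rw [dist_self_add_right]
      simp only [Complex.norm_mul, Complex.norm_I, mul_one, Complex.norm_real, Real.norm_eq_abs]
      rw [abs_of_pos (by positivity)]
      linarith
  · exact ⟨z, hz, by simpa using hε⟩

theorem dense_offReal_diff {P : Set ℂ} (hP : P.Finite) : Dense (offReal \ P) :=
  dense_offReal.sdiff_finite hP

/-- A function continuous on the plane, holomorphic off the real line and off a finite set, is
entire. -/
theorem differentiable_of_continuous_of_offReal {f : ℂ → ℂ} {P : Set ℂ} (hP : P.Finite)
    (hf : Continuous f) (hd : DifferentiableOn ℂ f (offReal \ P)) : Differentiable ℂ f := by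
  have hoff : DifferentiableOn ℂ f offReal := by
    intro z hz
    have hfin : (P \ {z}).Finite := hP.subset Set.sdiff_subset
    have hmem : offReal \ (P \ {z}) ∈ 𝓝 z :=
      (isOpen_offReal.sdiff hfin.isClosed).mem_nhds ⟨hz, by simp⟩
    have := (Complex.differentiableOn_compl_singleton_and_continuousAt_iff hmem).1
      ⟨hd.mono (by
        intro y hy
        exact ⟨hy.1.1, fun hyP => hy.1.2 ⟨hyP, hy.2⟩⟩), hf.continuousAt⟩
    exact (this.differentiableAt hmem).differentiableWithinAt
  intro z
  by_cases hz : z ∈ offReal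
  · exact hoff.differentiableAt (isOpen_offReal.mem_nhds hz)
  · have hz0 : z.im = 0 := by simpa [offReal] using hz
    exact (differentiableOn_ball_of_continuousOn_of_offReal (r := 1) hz0 hf.continuousOn
      (hoff.mono Set.inter_subset_right)).differentiableAt (Metric.ball_mem_nhds z one_pos)

/-- A function holomorphic off the real line and off a finite set that has limits everywhere
extends to an entire function. -/
theorem exists_entire_extension {P : Set ℂ} (hP : P.Finite)
    {w : ℂ → ℂ} (hw : DifferentiableOn ℂ w (offReal \ P))
    (hl : ∀ z, z ∉ offReal \ P → ∃ y, Tendsto w (𝓝[offReal \ P] z) (𝓝 y)) :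
    ∃ E : ℂ → ℂ, Differentiable ℂ E ∧ Set.EqOn E w (offReal \ P) ∧
      ∀ z y, Tendsto w (𝓝[offReal \ P] z) (𝓝 y) → E z = y := by
  have hd := dense_offReal_diff hP
  have hlim : ∀ z, ∃ y, Tendsto w (𝓝[offReal \ P] z) (𝓝 y) := by
    intro z
    by_cases hz : z ∈ offReal \ P
    · exact ⟨_, hw.continuousOn z hz⟩
    · exact hl z hz
  have heq : Set.EqOn (extendFrom (offReal \ P) w) w (offReal \ P) :=
    extendFrom_extends hw.continuousOn
  refine ⟨extendFrom (offReal \ P) w, ?_, heq, fun z y h => extendFrom_eq (hd z) h⟩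
  refine differentiable_of_continuous_of_offReal hP ?_ (hw.congr heq)
  rw [← continuousOn_univ]
  exact continuousOn_extendFrom (fun z _ => hd z) fun z _ => hlim z

/-- A parametrized family of entire functions that tends to zero, locally uniformly, along a circle
without its real points, tends to zero uniformly on the disk. -/
theorem tendsto_zero_of_tendsto_sphere {A : Type*} {l : Filter A} {H : A → ℂ → ℂ}
    (hH : ∀ᶠ a in l, Differentiable ℂ (H a)) {R : ℝ} (hR : 0 < R)
    (h : ∀ w ∈ Metric.sphere (0 : ℂ) R,
      Tendsto (fun p : A × ℂ => H p.1 p.2) (l ×ˢ 𝓝[offReal] w) (𝓝 0))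
    {v : A → ℂ} (hv : ∀ᶠ a in l, v a ∈ Metric.closedBall 0 R) :
    Tendsto (fun a => H a (v a)) l (𝓝 0) := by
  rw [Metric.tendsto_nhds]
  intro ε hε
  have hall : ∀ᶠ a in l, ∀ w ∈ Metric.sphere (0 : ℂ) R, ‖H a w‖ ≤ ε / 2 := by
    refine (isCompact_sphere (0 : ℂ) R).induction_on
      (p := fun s => ∀ᶠ a in l, ∀ w ∈ s, ‖H a w‖ ≤ ε / 2) (by simp) ?_ ?_ ?_
    · intro s t hst ht
      filter_upwards [ht] with a ha w hw using ha w (hst hw)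
    · intro s t hs ht
      filter_upwards [hs, ht] with a ha hb w hw
      exact hw.elim (ha w) (hb w)
    · intro w hw
      have := (Metric.tendsto_nhds.1 (h w hw)) (ε / 2) (by positivity)
      obtain ⟨p, hp, s, hs, hps⟩ := eventually_prod_iff.1 this
      obtain ⟨U, hU, hwU, hUs⟩ := mem_nhdsWithin.1 hs
      -- The bound is known only off the real line; density and continuity of `H a` extend it to the
      -- real points of the circle.
      refine ⟨U, mem_nhdsWithin_of_mem_nhds (hU.mem_nhds hwU), ?_⟩
      filter_upwards [hp, hH] with a ha hd z hz
      have hcl : z ∈ closure (U ∩ offReal) := dense_offReal.open_subset_closure_inter hU hz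
      refine closure_minimal (t := {z | ‖H a z‖ ≤ ε / 2}) ?_
        (isClosed_le hd.continuous.norm continuous_const) hcl
      intro y hy
      have := hps ha (hUs hy)
      simpa using this.le
  filter_upwards [hall, hH, hv] with a ha hd hva
  rw [dist_zero_right]
  refine lt_of_le_of_lt ?_ (half_lt_self hε)
  refine Complex.norm_le_of_forall_mem_frontier_norm_le (U := Metric.ball 0 R)
    Metric.isBounded_ball hd.diffContOnCl ?_ ?_
  · rw [frontier_ball _ hR.ne']
    exact ha
  · rwa [closure_ball _ hR.ne']

/-! ### Phases and the quotient of two solutions -/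

theorem expSigma3_mul (a b : ℂ) : expSigma3 a * expSigma3 b = expSigma3 (a + b) := by
  simp [expSigma3, Complex.exp_add, mul_comm]

@[simp]
theorem expSigma3_zero : expSigma3 0 = 1 := by
  simp [expSigma3, Matrix.one_fin_two]

@[simp]
theorem adjugate_expSigma3 (a : ℂ) : adjugate (expSigma3 a) = expSigma3 (-a) := by
  simp [expSigma3, Matrix.adjugate_fin_two]

theorem continuous_expSigma3 : Continuous expSigma3 := by
  refine continuous_matrix fun i j => ?_
  fin_cases i <;> fin_cases j <;> simp [expSigma3] <;> fun_prop

theorem two_mul_phase (x t : ℝ) {k : ℂ} (hk : k ≠ 0) :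
    2 * Complex.I * (k * x - t / (4 * k)) = 2 * phase x t k := by
  have h := Complex.I_mul_I
  unfold phase
  field_simp
  linear_combination -(t : ℂ) * h

theorem differentiableAt_phase (x t : ℝ) {k : ℂ} (hk : k ≠ 0) :
    DifferentiableAt ℂ (phase x t) k := by
  unfold phase
  refine DifferentiableAt.add (by fun_prop) (DifferentiableAt.div (by fun_prop) (by fun_prop) ?_)
  simp [hk]

theorem continuous_adjugate : Continuous (adjugate : Mat → Mat) :=
  continuous_id.matrix_adjugate

/-- The quotient `M' exp (-(Q' - Q)) M⁻¹` of two solutions (with the adjugate for the inverse), for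
the difference `d` of the phases. -/
noncomputable def transfer (M' M : ℂ → Mat) (d : ℂ → ℂ) (z : ℂ) : Mat :=
  M' z * expSigma3 (-d z) * adjugate (M z)

/-- The Wronskian of a row of `M'` and a row of `M`, twisted by the phase difference `d`. -/
noncomputable def twistedWronskian (M' M : ℂ → Mat) (d : ℂ → ℂ) (i l : Fin 2) (z : ℂ) : ℂ :=
  M' z i 0 * Complex.exp (-d z) * M z l 1 - M' z i 1 * Complex.exp (d z) * M z l 0

/-- The adjugate makes each product in an entry contain exactly one first-column and one
second-column factor. Since the two columns have poles in opposite half-planes, no double poles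
arise. -/
theorem transfer_apply_zero (M' M : ℂ → Mat) (d : ℂ → ℂ) (z : ℂ) (i : Fin 2) :
    transfer M' M d z i 0 = twistedWronskian M' M d i 1 z := by
  fin_cases i <;>
    simp [transfer, twistedWronskian, expSigma3, Matrix.mul_apply, Fin.sum_univ_two,
      Matrix.adjugate_fin_two] <;> ring

theorem transfer_apply_one (M' M : ℂ → Mat) (d : ℂ → ℂ) (z : ℂ) (i : Fin 2) :
    transfer M' M d z i 1 = -twistedWronskian M' M d i 0 z := by
  fin_cases i <;>
    simp [transfer, twistedWronskian, expSigma3, Matrix.mul_apply, Fin.sum_univ_two,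
      Matrix.adjugate_fin_two] <;> ring

theorem tendsto_transfer {M' M : ℂ → Mat} {d : ℂ → ℂ} {l : Filter ℂ} {A' A : Mat} {c : ℂ}
    (hM' : Tendsto M' l (𝓝 A')) (hM : Tendsto M l (𝓝 A)) (hd : Tendsto d l (𝓝 c)) :
    Tendsto (transfer M' M d) l (𝓝 (A' * expSigma3 (-c) * adjugate A)) :=
  (hM'.mul ((continuous_expSigma3.tendsto _).comp hd.neg)).mul ((continuous_adjugate.tendsto _).comp hM)

theorem exists_tendsto_of_tendsto_sub_mul_zero {g : ℂ → ℂ} {p : ℂ}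
    (hd : ∀ᶠ z in 𝓝[≠] p, DifferentiableAt ℂ g z)
    (h0 : Tendsto (fun z => (z - p) * g z) (𝓝[≠] p) (𝓝 0)) :
    ∃ y, Tendsto g (𝓝[≠] p) (𝓝 y) := by
  refine ⟨_, Complex.tendsto_limUnder_of_differentiable_on_punctured_nhds_of_isLittleO hd ?_⟩
  refine (Asymptotics.isLittleO_iff_tendsto' ?_).2 ?_
  · filter_upwards [self_mem_nhdsWithin] with z hz h
    exact absurd (sub_eq_zero.1 (inv_eq_zero.1 h)) hz
  -- The little-o form of Riemann's theorem subtracts the arbitrary value `g p`; after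
  -- multiplication by `z - p` it disappears in the limit.
  · have h1 : Tendsto (fun z : ℂ => (z - p) * g p) (𝓝[≠] p) (𝓝 0) := by
      have : Tendsto (fun z : ℂ => (z - p) * g p) (𝓝 p) (𝓝 ((p - p) * g p)) :=
        Continuous.tendsto (by fun_prop) p
      simpa using this.mono_left nhdsWithin_le_nhds
    have := h0.sub h1
    simp only [sub_zero] at this
    refine this.congr fun z => ?_
    rw [div_inv_eq_mul]
    ring

/-! ### Cancellation of poles and jumps in the quotient -/

namespace SpectralData

variable (D : SpectralData)

/-- The points at which a solution may have a pole. -/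
def poles : Set ℂ := Set.range D.k ∪ Set.range fun j => star (D.k j)

theorem finite_poles : D.poles.Finite :=
  (Set.finite_range _).union (Set.finite_range _)

theorem poles_subset_offReal : D.poles ⊆ offReal := by
  rintro p (⟨j, rfl⟩ | ⟨j, rfl⟩)
  · exact (D.k_im_pos j).ne'
  · simpa [offReal] using (D.k_im_pos j).ne'

theorem k_mem (j : Fin D.N) : D.k j ∈ offReal \ Set.range fun j => star (D.k j) := by
  refine ⟨(D.k_im_pos j).ne', ?_⟩
  rintro ⟨l, hl⟩
  have h1 := D.k_im_pos j
  have h2 := D.k_im_pos l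
  have := congrArg Complex.im hl
  simp at this
  linarith

theorem star_k_mem (j : Fin D.N) : star (D.k j) ∈ offReal \ Set.range D.k := by
  refine ⟨by simpa [offReal] using (D.k_im_pos j).ne', ?_⟩
  rintro ⟨l, hl⟩
  have h1 := D.k_im_pos j
  have h2 := D.k_im_pos l
  have := congrArg Complex.im hl
  simp at this
  linarith

theorem isOpen_fst : IsOpen (offReal \ Set.range D.k) :=
  isOpen_offReal.sdiff (Set.finite_range _).isClosed

theorem isOpen_snd : IsOpen (offReal \ Set.range fun j => star (D.k j)) :=
  isOpen_offReal.sdiff (Set.finite_range _).isClosed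

/-- The domain of holomorphy of both columns of a solution. -/
def regular : Set ℂ := offReal \ D.poles

theorem regular_subset_fst : D.regular ⊆ offReal \ Set.range D.k :=
  fun _ h => ⟨h.1, fun h' => h.2 (Or.inl h')⟩

theorem regular_subset_snd : D.regular ⊆ offReal \ Set.range fun j => star (D.k j) :=
  fun _ h => ⟨h.1, fun h' => h.2 (Or.inr h')⟩

theorem ne_zero_of_mem_offReal {z : ℂ} (hz : z ∈ offReal) : z ≠ 0 := by
  rintro rfl
  simp [offReal] at hz

theorem eventually_regular_nhdsNE {p : ℂ} (hp : p ∈ offReal) : ∀ᶠ z in 𝓝[≠] p, z ∈ D.regular := by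
  have hfin : (D.poles \ {p}).Finite := D.finite_poles.subset Set.sdiff_subset
  have hmem : offReal \ (D.poles \ {p}) ∈ 𝓝 p :=
    (isOpen_offReal.sdiff hfin.isClosed).mem_nhds ⟨hp, by simp⟩
  filter_upwards [mem_nhdsWithin_of_mem_nhds hmem, self_mem_nhdsWithin] with z hz hzp
  exact ⟨hz.1, fun h => hz.2 ⟨h, hzp⟩⟩

theorem J_eq (x t s : ℝ) : D.J x t s =
    expSigma3 (-phase x t s) * D.J0 s * expSigma3 (phase x t s) := rfl

theorem J0_mul_adjugate (s : ℝ) : D.J0 s * adjugate (D.J0 s) = 1 := by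
  rw [mul_adjugate, J0, det_fin_two_of]
  have : (1 + (‖D.r s‖ : ℂ) ^ 2) * 1 - star (D.r s) * D.r s = 1 := by
    have := Complex.conj_mul' (D.r s)
    simp only [Complex.star_def]
    rw [this]
    ring
  rw [this, one_smul]

variable {D}

namespace IsRHSolution

variable {x t x' t' : ℝ} {M M' : ℂ → Mat}

theorem differentiableAt_entry (h : D.IsRHSolution x t M) {z : ℂ} (hz : z ∈ D.regular)
    (i j : Fin 2) : DifferentiableAt ℂ (fun z => M z i j) z := by
  fin_cases j
  · exact (h.holo_fst i).differentiableAt (D.isOpen_fst.mem_nhds (D.regular_subset_fst hz))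
  · exact (h.holo_snd i).differentiableAt (D.isOpen_snd.mem_nhds (D.regular_subset_snd hz))

theorem differentiableAt_twistedWronskian (h : D.IsRHSolution x t M)
    (h' : D.IsRHSolution x' t' M') {z : ℂ} (hz : z ∈ D.regular) (i l : Fin 2) :
    DifferentiableAt ℂ (twistedWronskian M' M (fun z => phase x' t' z - phase x t z) i l) z := by
  have hz0 := ne_zero_of_mem_offReal hz.1
  have hd : DifferentiableAt ℂ (fun z => phase x' t' z - phase x t z) z :=
    (differentiableAt_phase x' t' hz0).sub (differentiableAt_phase x t hz0)
  exact (((h'.differentiableAt_entry hz i 0).mul hd.neg.cexp).mul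
    (h.differentiableAt_entry hz l 1)).sub
    (((h'.differentiableAt_entry hz i 1).mul hd.cexp).mul (h.differentiableAt_entry hz l 0))

theorem differentiableOn_transfer (h : D.IsRHSolution x t M)
    (h' : D.IsRHSolution x' t' M') (i j : Fin 2) :
    DifferentiableOn ℂ (fun z => transfer M' M (fun z => phase x' t' z - phase x t z) z i j)
      D.regular := by
  intro z hz
  refine DifferentiableAt.differentiableWithinAt ?_
  fin_cases j
  · simp only [Fin.zero_eta, transfer_apply_zero]
    exact h.differentiableAt_twistedWronskian h' hz i 1
  · simp only [Fin.mk_one, transfer_apply_one]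
    exact (h.differentiableAt_twistedWronskian h' hz i 0).neg

/-- At a pole both solutions have residues proportional to their other column, with the same
constant `γ` up to the factors exp(±2 phase). The twist exp(∓d) balances these factors, so the two
terms of the Wronskian have equal residues. -/
theorem tendsto_sub_mul_twistedWronskian (h : D.IsRHSolution x t M)
    (h' : D.IsRHSolution x' t' M') {p : ℂ} (hp : p ∈ D.poles) (i l : Fin 2) :
    Tendsto (fun z => (z - p) *
      twistedWronskian M' M (fun z => phase x' t' z - phase x t z) i l z) (𝓝[≠] p) (𝓝 0) := by
  have hp0 := ne_zero_of_mem_offReal (D.poles_subset_offReal hp)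
  have hd : Tendsto (fun z => phase x' t' z - phase x t z) (𝓝[≠] p)
      (𝓝 (phase x' t' p - phase x t p)) :=
    (((differentiableAt_phase x' t' hp0).sub
      (differentiableAt_phase x t hp0)).continuousAt).tendsto.mono_left nhdsWithin_le_nhds
  have he1 := (Complex.continuous_exp.tendsto _).comp hd.neg
  have he2 := (Complex.continuous_exp.tendsto _).comp hd
  rcases hp with ⟨j, rfl⟩ | ⟨j, rfl⟩
  · have hc : ∀ {x t : ℝ} {M : ℂ → Mat}, D.IsRHSolution x t M → ∀ i,
        Tendsto (fun z => M z i 1) (𝓝[≠] (D.k j)) (𝓝 (M (D.k j) i 1)) := fun h i =>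
      ((h.holo_snd i).differentiableAt (D.isOpen_snd.mem_nhds (D.k_mem j))).continuousAt.tendsto.mono_left
        nhdsWithin_le_nhds
    have := (((h'.res_fst j i).mul he1).mul (hc h l)).sub (((hc h' i).mul he2).mul (h.res_fst j l))
    convert this using 1
    · ext z
      simp only [twistedWronskian, Function.comp]
      ring
    · rw [two_mul_phase x' t' hp0, two_mul_phase x t hp0]
      congr 1
      have : Complex.exp (2 * phase x' t' (D.k j)) *
          Complex.exp (-(phase x' t' (D.k j) - phase x t (D.k j))) =
          Complex.exp (phase x' t' (D.k j) - phase x t (D.k j)) *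
          Complex.exp (2 * phase x t (D.k j)) := by
        rw [← Complex.exp_add, ← Complex.exp_add]
        ring_nf
      linear_combination -(Complex.I * D.γ j * M' (D.k j) i 1 * M (D.k j) l 1) * this
  · beta_reduce at hp0 he1 he2 hd ⊢
    have hc : ∀ {x t : ℝ} {M : ℂ → Mat}, D.IsRHSolution x t M → ∀ i,
        Tendsto (fun z => M z i 0) (𝓝[≠] (star (D.k j))) (𝓝 (M (star (D.k j)) i 0)) := fun h i =>
      ((h.holo_fst i).differentiableAt
        (D.isOpen_fst.mem_nhds (D.star_k_mem j))).continuousAt.tendsto.mono_left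
        nhdsWithin_le_nhds
    have := (((hc h' i).mul he1).mul (h.res_snd j l)).sub (((h'.res_snd j i).mul he2).mul (hc h l))
    have hneg : ∀ x t : ℝ, -2 * Complex.I * (star (D.k j) * x - t / (4 * star (D.k j))) =
        -(2 * phase x t (star (D.k j))) := by
      intro x t
      rw [← two_mul_phase x t hp0]
      ring
    convert this using 1
    · ext z
      simp only [twistedWronskian, Function.comp]
      ring
    · rw [hneg, hneg]
      congr 1
      generalize star (D.k j) = p
      have : Complex.exp (-(2 * phase x' t' p)) * Complex.exp (phase x' t' p - phase x t p) =
          Complex.exp (-(phase x' t' p - phase x t p)) * Complex.exp (-(2 * phase x t p)) := by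
        rw [← Complex.exp_add, ← Complex.exp_add]
        ring_nf
      linear_combination (Complex.I * star (D.γ j) * M' p i 0 * M p l 0) * this

theorem exists_tendsto_transfer_of_pole (h : D.IsRHSolution x t M)
    (h' : D.IsRHSolution x' t' M') {p : ℂ} (hp : p ∈ D.poles) :
    ∃ Y, Tendsto (transfer M' M (fun z => phase x' t' z - phase x t z)) (𝓝[≠] p) (𝓝 Y) := by
  have key : ∀ i l, ∃ y, Tendsto
      (twistedWronskian M' M (fun z => phase x' t' z - phase x t z) i l) (𝓝[≠] p) (𝓝 y) :=
    fun i l => exists_tendsto_of_tendsto_sub_mul_zero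
      ((D.eventually_regular_nhdsNE (D.poles_subset_offReal hp)).mono fun z hz =>
        h.differentiableAt_twistedWronskian h' hz i l)
      (h.tendsto_sub_mul_twistedWronskian h' hp i l)
  choose y hy using key
  refine ⟨Matrix.of fun i j => if j = 0 then y i 1 else -y i 0, ?_⟩
  refine tendsto_pi_nhds.2 fun i => tendsto_pi_nhds.2 fun j => ?_
  fin_cases j
  · simpa [transfer_apply_zero] using hy i 1
  · simpa [transfer_apply_one] using (hy i 0).neg

/-- The exponentials between the two jump matrices multiply to the identity, leaving `J0` times its
adjugate, which is 1. The limits from both half-planes therefore agree. The origin is excluded, as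
the phases are singular there. -/
theorem exists_tendsto_transfer_of_real (h : D.IsRHSolution x t M)
    (h' : D.IsRHSolution x' t' M') {s : ℝ} (hs : s ≠ 0) :
    ∃ Y, Tendsto (transfer M' M (fun z => phase x' t' z - phase x t z)) (𝓝[offReal] (s : ℂ))
      (𝓝 Y) := by
  obtain ⟨Mp, Mm, hJ⟩ := h.jump
  obtain ⟨Mp', Mm', hJ'⟩ := h'.jump
  have hs0 : (s : ℂ) ≠ 0 := by exact_mod_cast hs
  have hd : Tendsto (fun z => phase x' t' z - phase x t z) (𝓝 (s : ℂ))
      (𝓝 (phase x' t' s - phase x t s)) :=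
    (((differentiableAt_phase x' t' hs0).sub
      (differentiableAt_phase x t hs0)).continuousAt).tendsto
  have hup := tendsto_transfer (hJ' s).1 (hJ s).1 (hd.mono_left nhdsWithin_le_nhds)
  have hdn := tendsto_transfer (hJ' s).2.1 (hJ s).2.1 (hd.mono_left nhdsWithin_le_nhds)
  have heq : Mp' s * expSigma3 (-(phase x' t' s - phase x t s)) * adjugate (Mp s) =
      Mm' s * expSigma3 (-(phase x' t' s - phase x t s)) * adjugate (Mm s) := by
    rw [(hJ s).2.2 hs, (hJ' s).2.2 hs, J_eq, J_eq]
    simp only [adjugate_mul_distrib, adjugate_expSigma3, neg_neg]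
    generalize phase x' t' s = a
    generalize phase x t s = b
    have e1 : expSigma3 a * expSigma3 (-(a - b)) * expSigma3 (-b) = 1 := by
      rw [expSigma3_mul, expSigma3_mul]
      ring_nf
      simp
    have e2 : expSigma3 (-a) * expSigma3 b = expSigma3 (-(a - b)) := by
      rw [expSigma3_mul]
      ring_nf
    calc _ = Mm' s * (expSigma3 (-a) * (D.J0 s *
          (expSigma3 a * expSigma3 (-(a - b)) * expSigma3 (-b)) * adjugate (D.J0 s)) *
            expSigma3 b) * adjugate (Mm s) := by
          simp only [Matrix.mul_assoc]
      _ = _ := by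
          rw [e1, Matrix.mul_one, J0_mul_adjugate, Matrix.mul_one, e2]
  have hsplit : offReal = {z : ℂ | 0 < z.im} ∪ {z : ℂ | z.im < 0} := by
    ext z
    simp only [offReal, Set.mem_ofPred_eq, Set.mem_union]
    rw [ne_iff_lt_or_gt, or_comm]
  rw [heq] at hup
  rw [hsplit, nhdsWithin_union]
  exact ⟨_, hup.sup hdn⟩

theorem exists_tendsto_transfer (h : D.IsRHSolution x t M)
    (h' : D.IsRHSolution x' t' M') {z : ℂ} (hz : z ≠ 0) :
    ∃ Y, Tendsto (transfer M' M (fun z => phase x' t' z - phase x t z)) (𝓝[D.regular] z)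
      (𝓝 Y) := by
  by_cases him : z ∈ offReal
  · by_cases hp : z ∈ D.poles
    · obtain ⟨Y, hY⟩ := h.exists_tendsto_transfer_of_pole h' hp
      refine ⟨Y, hY.mono_left (nhdsWithin_mono _ fun w hw => ?_)⟩
      rintro rfl
      exact hw.2 hp
    · exact ⟨_, tendsto_pi_nhds.2 fun i => tendsto_pi_nhds.2 fun j =>
        (h.differentiableOn_transfer h' i j).continuousOn z ⟨him, hp⟩⟩
  · have hz' : z = (z.re : ℂ) := by
      have : z.im = 0 := by simpa [offReal] using him
      apply Complex.ext <;> simp [this]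
    rw [hz']
    obtain ⟨Y, hY⟩ := h.exists_tendsto_transfer_of_real h' (s := z.re) (by
      intro h0
      exact hz (by rw [hz', h0, Complex.ofReal_zero]))
    exact ⟨Y, hY.mono_left (nhdsWithin_mono _ fun w hw => hw.1)⟩

end IsRHSolution

end SpectralData

/-! ### Rescaling and the maximum principle: zeroth order -/

/-- `k → ∞` off the real line. -/
noncomputable abbrev offRealInfty : Filter ℂ := cocompact ℂ ⊓ 𝓟 offReal

/-- Entrywise holomorphic matrix functions on the plane. -/
def IsEntire (E : ℂ → Mat) : Prop := ∀ i j, Differentiable ℂ fun z => E z i j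

theorem tendsto_mat_iff {A : Type*} {l : Filter A} {f : A → Mat} {B : Mat} :
    Tendsto f l (𝓝 B) ↔ ∀ i j, Tendsto (fun a => f a i j) l (𝓝 (B i j)) := by
  exact tendsto_pi_nhds.trans (forall_congr' fun i => tendsto_pi_nhds)

theorem div_mem_offReal {r : ℝ} (hr : r ≠ 0) {z : ℂ} (hz : z ∈ offReal) : z / r ∈ offReal := by
  have : (z / r).im = z.im / r := Complex.div_ofReal_im z r
  simp only [offReal, Set.mem_ofPred_eq, this] at hz ⊢
  exact div_ne_zero hz hr

theorem inv_mem_offReal {z : ℂ} (hz : z ∈ offReal) : z⁻¹ ∈ offReal := by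
  have h0 := SpectralData.ne_zero_of_mem_offReal hz
  simp only [offReal, Set.mem_ofPred_eq, Complex.inv_im] at hz ⊢
  exact div_ne_zero (neg_ne_zero.2 hz) (Complex.normSq_pos.2 h0).ne'

/-- Rescaling by a parameter that tends to zero sends neighbourhoods of a nonzero point to
neighbourhoods of infinity. -/
theorem tendsto_div_offRealInfty {A : Type*} {l : Filter A} {δ : A → ℝ}
    (hδ : Tendsto δ l (𝓝[≠] 0)) {w : ℂ} (hw : w ≠ 0) :
    Tendsto (fun p : A × ℂ => p.2 / δ p.1) (l ×ˢ 𝓝[offReal] w) offRealInfty := by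
  refine tendsto_inf.2 ⟨?_, tendsto_principal.2 ?_⟩
  · rw [← Metric.cobounded_eq_cocompact, ← tendsto_norm_atTop_iff_cobounded]
    simp only [norm_div, Complex.norm_real]
    simp only [div_eq_mul_inv]
    have h1 : Tendsto (fun p : A × ℂ => ‖p.2‖) (l ×ˢ 𝓝[offReal] w) (𝓝 ‖w‖) :=
      ((continuous_norm.tendsto w).mono_left nhdsWithin_le_nhds).comp tendsto_snd
    have h2 : Tendsto (fun p : A × ℂ => ‖δ p.1‖⁻¹) (l ×ˢ 𝓝[offReal] w) atTop :=
      ((tendsto_norm_inv_nhdsNE_zero_atTop (α := ℝ)).comp (hδ.comp tendsto_fst)).congr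
        fun p => norm_inv _
    exact h1.pos_mul_atTop (norm_pos_iff.2 hw) h2
  · have h1 : ∀ᶠ a in l, δ a ≠ 0 := hδ.eventually self_mem_nhdsWithin
    have h2 : ∀ᶠ z in 𝓝[offReal] w, z ∈ offReal := self_mem_nhdsWithin
    filter_upwards [h1.prod_mk h2] with p hp using div_mem_offReal hp.1 hp.2

theorem tendsto_inv_offRealInfty : Tendsto (fun z : ℂ => z⁻¹) offRealInfty (𝓝[offReal] 0) := by
  refine tendsto_inf.2 ⟨(tendsto_inv₀_cobounded (α := ℂ)).mono_left ?_, tendsto_principal.2 ?_⟩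
  · rw [Metric.cobounded_eq_cocompact]
    exact inf_le_left
  · filter_upwards [mem_inf_of_right (mem_principal_self _)] with z hz using inv_mem_offReal hz

theorem tendsto_inv_nhds_zero : Tendsto (fun z : ℂ => z⁻¹) (𝓝[offReal] 0) offRealInfty := by
  refine tendsto_inf.2 ⟨?_, tendsto_principal.2 ?_⟩
  · rw [← Metric.cobounded_eq_cocompact]
    refine (tendsto_inv₀_nhdsNE_zero (α := ℂ)).mono_left (nhdsWithin_mono _ fun z hz => ?_)
    exact SpectralData.ne_zero_of_mem_offReal hz
  · filter_upwards [self_mem_nhdsWithin] with z hz using inv_mem_offReal hz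

instance neBot_offRealInfty : NeBot offRealInfty := by
  have : NeBot (𝓝[offReal] (0 : ℂ)) := mem_closure_iff_nhdsWithin_neBot.1 (dense_offReal 0)
  exact tendsto_inv_nhds_zero.neBot

instance neBot_nhds_offReal (z : ℂ) : NeBot (𝓝[offReal] z) :=
  mem_closure_iff_nhdsWithin_neBot.1 (dense_offReal z)

/-- If the values of a family of entire functions at large points are quotients of functions with
limits at infinity, twisted by an exponential whose rate `δ` tends to zero, then the family has a
limit everywhere. -/
theorem tendsto_of_tendsto_offRealInfty {A : Type*} {l : Filter A} {δ : A → ℝ}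
    (hδ : Tendsto δ l (𝓝[≠] 0)) {E N' N : A → ℂ → Mat} {c : ℂ} {B' B : Mat}
    (hE : ∀ᶠ a in l, IsEntire (E a))
    (hEN : ∀ᶠ p : ℂ × A in offRealInfty ×ˢ l,
      E p.2 p.1 = N' p.2 p.1 * expSigma3 (c * (δ p.2 * p.1)) * adjugate (N p.2 p.1))
    (hN' : Tendsto (fun p : ℂ × A => N' p.2 p.1) (offRealInfty ×ˢ l) (𝓝 B'))
    (hN : Tendsto (fun p : ℂ × A => N p.2 p.1) (offRealInfty ×ˢ l) (𝓝 B)) (z : ℂ) :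
    Tendsto (fun a => E a z) l (𝓝 (B' * adjugate B)) := by
  set h : ℂ → Mat := fun w => B' * expSigma3 (c * w) * adjugate B with hh
  have hcont : Continuous h :=
    (continuous_const.mul (continuous_expSigma3.comp (by fun_prop))).mul continuous_const
  have hdiff : ∀ i j, Differentiable ℂ fun w => h w i j := by
    intro i j
    simp only [hh, expSigma3, Matrix.mul_apply, Fin.sum_univ_two]
    simp only [Matrix.of_apply, Matrix.cons_val', Matrix.cons_val_zero, Matrix.cons_val_one,
      Matrix.cons_val_fin_one]
    fun_prop
  -- Substituting `w / δ` for the argument turns the exponent `c * (δ * z)` into `c * w`, while `w /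
  -- δ` runs to infinity, where `N'` and `N` have limits.
  have hsphere : ∀ w ∈ Metric.sphere (0 : ℂ) 1,
      Tendsto (fun p : A × ℂ => E p.1 (p.2 / δ p.1)) (l ×ˢ 𝓝[offReal] w) (𝓝 (h w)) := by
    intro w hw
    have hw0 : w ≠ 0 := by
      rintro rfl
      simp at hw
    have hT : Tendsto (fun p : A × ℂ => (p.2 / δ p.1, p.1)) (l ×ˢ 𝓝[offReal] w)
        (offRealInfty ×ˢ l) := (tendsto_div_offRealInfty hδ hw0).prodMk tendsto_fst
    have hexp : Tendsto (fun p : A × ℂ => expSigma3 (c * p.2)) (l ×ˢ 𝓝[offReal] w)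
        (𝓝 (expSigma3 (c * w))) := by
      have : Tendsto (fun w => expSigma3 (c * w)) (𝓝 w) (𝓝 (expSigma3 (c * w))) :=
        (continuous_expSigma3.comp (by fun_prop : Continuous fun w => c * w)).tendsto w
      exact (this.mono_left nhdsWithin_le_nhds).comp tendsto_snd
    refine (((hN'.comp hT).mul hexp).mul
      ((continuous_adjugate.tendsto _).comp (hN.comp hT))).congr' ?_
    have h1 : ∀ᶠ a in l, δ a ≠ 0 := hδ.eventually self_mem_nhdsWithin
    filter_upwards [hT.eventually hEN, h1.prod_inl _] with p hp hp0
    have hp0' : (δ p.1 : ℂ) ≠ 0 := by exact_mod_cast hp0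
    simp only [Function.comp] at hp ⊢
    rw [hp, mul_div_cancel₀ _ hp0']
  have hδ0 : Tendsto (fun a => (δ a : ℂ) * z) l (𝓝 0) := by
    have := (Complex.continuous_ofReal.tendsto 0).comp (hδ.mono_right nhdsWithin_le_nhds)
    simpa using this.mul_const z
  -- In the rescaled variable the fixed point `z` sits at `δ * z`, eventually inside the unit disk
  -- and tending to its centre.
  have key : ∀ i j, Tendsto (fun a => E a z i j - h (δ a * z) i j) l (𝓝 0) := by
    intro i j
    have := tendsto_zero_of_tendsto_sphere (l := l)
      (H := fun a w => E a (w / δ a) i j - h w i j) (v := fun a => δ a * z) (R := 1)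
      (by
        filter_upwards [hE] with a ha
        exact ((ha i j).comp (by fun_prop : Differentiable ℂ fun w : ℂ => w / δ a)).sub (hdiff i j))
      one_pos
      (by
        intro w hw
        have h1 := tendsto_mat_iff.1 (hsphere w hw) i j
        have h2 := tendsto_mat_iff.1
          (((hcont.tendsto w).mono_left nhdsWithin_le_nhds).comp
            (tendsto_snd (f := l) (g := 𝓝[offReal] w))) i j
        simpa using h1.sub h2)
      (hδ0.eventually (Metric.closedBall_mem_nhds 0 one_pos))
    refine this.congr' ?_
    filter_upwards [hδ.eventually self_mem_nhdsWithin] with a ha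
    have ha' : (δ a : ℂ) ≠ 0 := by exact_mod_cast ha
    simp only [mul_div_cancel_left₀ z ha']
  refine tendsto_mat_iff.2 fun i j => ?_
  have h2 := tendsto_mat_iff.1 ((hcont.tendsto 0).comp hδ0) i j
  have h0 : h 0 = B' * adjugate B := by simp [hh]
  rw [h0] at h2
  simpa using (key i j).add h2

/-! ### Entire quotients and the determinant -/

namespace SpectralData

variable (D : SpectralData)

theorem eventually_offRealInfty_regular : ∀ᶠ z in offRealInfty, z ∈ D.regular := by
  have h1 : ∀ᶠ z in offRealInfty, z ∈ D.polesᶜ :=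
    mem_inf_of_left D.finite_poles.isCompact.compl_mem_cocompact
  filter_upwards [h1, mem_inf_of_right (mem_principal_self _)] with z hz hz' using ⟨hz', hz⟩

theorem eventually_nhds_zero_regular : ∀ᶠ z in 𝓝[offReal] 0, z ∈ D.regular := by
  have h1 : D.polesᶜ ∈ 𝓝 (0 : ℂ) := D.finite_poles.isClosed.isOpen_compl.mem_nhds fun h =>
    ne_zero_of_mem_offReal (D.poles_subset_offReal h) rfl
  filter_upwards [mem_nhdsWithin_of_mem_nhds h1, self_mem_nhdsWithin] with z hz hz' using ⟨hz', hz⟩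

variable {D}

namespace IsRHSolution

variable {x t x' t' : ℝ} {M M' : ℂ → Mat}

/-- The singular parts t/(4ik) of the phases cancel, so the phase difference is linear in k. The
only point not covered by the cancellations above is k = 0, where the limits `A'` and `A` serve. -/
theorem exists_entire_of_eq_time (h : D.IsRHSolution x t M) (h' : D.IsRHSolution x' t M')
    {A A' : Mat} (hA : Tendsto M (𝓝[offReal] 0) (𝓝 A)) (hA' : Tendsto M' (𝓝[offReal] 0) (𝓝 A')) :
    ∃ E : ℂ → Mat, IsEntire E ∧
      (∀ z ∈ D.regular, E z =
        M' z * expSigma3 (-Complex.I * ((x' - x : ℝ) * z)) * adjugate (M z)) ∧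
      E 0 = A' * adjugate A := by
  set d := fun z => phase x' t z - phase x t z with hd
  have hd' : ∀ z, d z = Complex.I * ((x' - x : ℝ) * z) := by
    intro z
    simp only [hd, phase]
    push_cast
    ring
  have h0 : Tendsto (transfer M' M d) (𝓝[D.regular] 0) (𝓝 (A' * adjugate A)) := by
    have hlim : Tendsto d (𝓝[offReal] 0) (𝓝 0) := by
      have : Tendsto d (𝓝 0) (𝓝 (d 0)) := by
        have hc : Continuous d := by
          rw [funext hd']
          fun_prop
        exact hc.tendsto 0
      rw [hd' 0, mul_zero, mul_zero] at this
      exact this.mono_left nhdsWithin_le_nhds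
    have := tendsto_transfer hA' hA hlim
    simp only [neg_zero, expSigma3_zero, mul_one] at this
    exact this.mono_left (nhdsWithin_mono _ fun z hz => hz.1)
  have hall : ∀ z, ∃ Y, Tendsto (transfer M' M d) (𝓝[D.regular] z) (𝓝 Y) := by
    intro z
    by_cases hz : z = 0
    · subst hz
      exact ⟨_, h0⟩
    · exact h.exists_tendsto_transfer h' hz
  have hex := fun i j => exists_entire_extension D.finite_poles (h.differentiableOn_transfer h' i j)
    (fun z _ => (hall z).imp' (fun Y => Y i j) fun Y hY => tendsto_mat_iff.1 hY i j)
  choose E hE hEq hElim using hex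
  refine ⟨fun z => Matrix.of fun i j => E i j z, fun i j => hE i j, ?_, ?_⟩
  · intro z hz
    ext i j
    simp only [Matrix.of_apply]
    rw [hEq i j hz]
    change (M' z * expSigma3 (-d z) * adjugate (M z)) i j = _
    rw [hd' z, neg_mul]
  · ext i j
    exact hElim i j 0 _ (tendsto_mat_iff.1 h0 i j)

/-- The phase difference is now a multiple of 1/k, so the quotient may have an essential singularity
at k = 0. In the variable 1/k this is moved to infinity, and the origin is covered by the
normalization at k = ∞. -/
theorem exists_entire_of_eq_space (h : D.IsRHSolution x t M) (h' : D.IsRHSolution x t' M') :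
    ∃ E : ℂ → Mat, IsEntire E ∧
      (∀ z ∈ D.regular, E z⁻¹ =
        M' z * expSigma3 (Complex.I / 4 * ((t' - t : ℝ) * z⁻¹)) * adjugate (M z)) ∧
      E 0 = 1 := by
  set d := fun z => phase x t' z - phase x t z with hd
  have hd' : ∀ z, d z = -(Complex.I / 4 * ((t' - t : ℝ) * z⁻¹)) := by
    intro z
    simp only [hd, phase, div_eq_mul_inv, mul_inv, Complex.inv_I]
    push_cast
    ring
  have hinv : ((fun z : ℂ => z⁻¹) ⁻¹' D.regular) = offReal \ (fun z : ℂ => z⁻¹) ⁻¹' D.poles := by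
    ext z
    refine ⟨fun hz => ⟨?_, hz.2⟩, fun hz => ⟨inv_mem_offReal hz.1, hz.2⟩⟩
    simpa using inv_mem_offReal hz.1
  have hfin : ((fun z : ℂ => z⁻¹) ⁻¹' D.poles).Finite :=
    D.finite_poles.preimage inv_injective.injOn
  have h0 : Tendsto (fun z => transfer M' M d z⁻¹) (𝓝[offReal] 0) (𝓝 1) := by
    have hlim : Tendsto d offRealInfty (𝓝 0) := by
      rw [funext hd']
      have h1 : Tendsto (fun z : ℂ => z⁻¹) offRealInfty (𝓝 0) :=
        tendsto_inv_offRealInfty.mono_right nhdsWithin_le_nhds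
      simpa using ((h1.const_mul ((t' - t : ℝ) : ℂ)).const_mul (Complex.I / 4)).neg
    have := tendsto_transfer h'.norm_infty h.norm_infty hlim
    simp only [neg_zero, expSigma3_zero, mul_one, adjugate_one] at this
    exact this.comp tendsto_inv_nhds_zero
  have hall : ∀ z, ∃ Y, Tendsto (fun z => transfer M' M d z⁻¹)
      (𝓝[offReal \ (fun z : ℂ => z⁻¹) ⁻¹' D.poles] z) (𝓝 Y) := by
    intro z
    by_cases hz : z = 0
    · subst hz
      exact ⟨_, h0.mono_left (nhdsWithin_mono _ fun z hz => hz.1)⟩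
    · obtain ⟨Y, hY⟩ := h.exists_tendsto_transfer h' (inv_ne_zero hz)
      refine ⟨Y, hY.comp ?_⟩
      rw [← hinv]
      refine tendsto_nhdsWithin_iff.2 ⟨?_, ?_⟩
      · exact (continuousAt_inv₀ hz).tendsto.mono_left nhdsWithin_le_nhds
      · exact self_mem_nhdsWithin
  have hdiff : ∀ i j, DifferentiableOn ℂ (fun z => transfer M' M d z⁻¹ i j)
      (offReal \ (fun z : ℂ => z⁻¹) ⁻¹' D.poles) := by
    intro i j
    refine (h.differentiableOn_transfer h' i j).comp (g := fun z => transfer M' M d z i j)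
      (f := fun z : ℂ => z⁻¹) ?_ ?_
    · exact fun z hz =>
        (differentiableAt_inv (ne_zero_of_mem_offReal hz.1)).differentiableWithinAt
    · rw [← hinv]
      exact fun z hz => hz
  have hex := fun i j => exists_entire_extension hfin (hdiff i j)
    (fun z _ => (hall z).imp' (fun Y => Y i j) fun Y hY => tendsto_mat_iff.1 hY i j)
  choose E hE hEq hElim using hex
  refine ⟨fun z => Matrix.of fun i j => E i j z, fun i j => hE i j, ?_, ?_⟩
  · intro z hz
    ext i j
    simp only [Matrix.of_apply]
    rw [hEq i j (by rw [← hinv]; simpa using hz)]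
    change (M' z⁻¹⁻¹ * expSigma3 (-d z⁻¹⁻¹) * adjugate (M z⁻¹⁻¹)) i j = _
    rw [hd', neg_neg, inv_inv]
  · ext i j
    exact hElim i j 0 _ (tendsto_mat_iff.1
      (h0.mono_left (nhdsWithin_mono _ fun z hz => hz.1)) i j)

/-- The quotient of a solution by itself is `det M` times the identity. It is entire and tends to 1
at infinity. -/
theorem det_eq_one (h : D.IsRHSolution x t M) {A : Mat} (hA : Tendsto M (𝓝[offReal] 0) (𝓝 A))
    {z : ℂ} (hz : z ∈ D.regular) : (M z).det = 1 := by
  obtain ⟨E, hE, hEM, -⟩ := h.exists_entire_of_eq_time h hA hA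
  have hlim := h.norm_infty.comp (tendsto_fst (f := offRealInfty) (g := 𝓝[≠] (0 : ℝ)))
  -- Liouville's theorem in disguise: a constant family with a dummy parameter and no twist (`c =
  -- 0`).
  have := tendsto_of_tendsto_offRealInfty (l := 𝓝[≠] (0 : ℝ)) (δ := id) tendsto_id
    (E := fun _ => E) (N' := fun _ => M) (N := fun _ => M) (c := 0) (B' := 1) (B := 1)
    (Eventually.of_forall fun _ => hE)
    (by
      filter_upwards [D.eventually_offRealInfty_regular.prod_inl _] with p hp
      simpa using hEM p.1 hp)
    hlim hlim z
  have h1 : E z = 1 := by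
    have := tendsto_nhds_unique tendsto_const_nhds this
    simpa using this
  have h2 := hEM z hz
  simp only [sub_self, Complex.ofReal_zero, zero_mul, mul_zero, expSigma3_zero, mul_one,
    mul_adjugate, h1] at h2
  have := congrFun (congrFun h2 0) 0
  simpa using this.symm

theorem det_eq_one_of_tendsto (h : D.IsRHSolution x t M) {A : Mat}
    (hA : Tendsto M (𝓝[offReal] 0) (𝓝 A)) : A.det = 1 := by
  have h1 : Tendsto (fun z => (M z).det) (𝓝[offReal] 0) (𝓝 A.det) :=
    ((continuous_id.matrix_det (R := ℂ) (n := Fin 2)).tendsto A).comp hA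
  refine tendsto_nhds_unique h1 (tendsto_const_nhds.congr' ?_)
  filter_upwards [D.eventually_nhds_zero_regular] with z hz using (h.det_eq_one hA hz).symm

end IsRHSolution

end SpectralData

/-! ### Rescaling and the maximum principle: first order -/

/-- The matrix `c σ₃`. -/
def sigma3 (c : ℂ) : Mat := !![c, 0; 0, -c]

/-- The entire function `(exp (c w σ₃) - 1) / w`. -/
noncomputable def expSlope (c w : ℂ) : Mat :=
  !![dslope (fun v => Complex.exp (c * v)) 0 w, 0; 0, dslope (fun v => Complex.exp (-(c * v))) 0 w]

theorem differentiable_dslope_zero {f : ℂ → ℂ} (hf : Differentiable ℂ f) :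
    Differentiable ℂ (dslope f 0) := by
  rw [← differentiableOn_univ] at hf ⊢
  exact (Complex.differentiableOn_dslope univ_mem).2 hf

theorem isEntire_expSlope (c : ℂ) : IsEntire (expSlope c) := by
  have h1 := differentiable_dslope_zero
    (by fun_prop : Differentiable ℂ fun v : ℂ => Complex.exp (c * v))
  have h2 := differentiable_dslope_zero
    (by fun_prop : Differentiable ℂ fun v : ℂ => Complex.exp (-(c * v)))
  intro i j
  fin_cases i <;> fin_cases j <;> simp [expSlope] <;> assumption

theorem continuous_expSlope (c : ℂ) : Continuous (expSlope c) :=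
  continuous_matrix fun i j => (isEntire_expSlope c i j).continuous

theorem smul_expSlope (c w : ℂ) : w • expSlope c w = expSigma3 (c * w) - 1 := by
  have h1 := sub_smul_dslope (fun v => Complex.exp (c * v)) 0 w
  have h2 := sub_smul_dslope (fun v => Complex.exp (-(c * v))) 0 w
  simp only [sub_zero, smul_eq_mul, mul_zero, neg_zero, Complex.exp_zero] at h1 h2
  ext i j
  fin_cases i <;> fin_cases j <;> simp [expSlope, expSigma3, h1, h2]

theorem expSlope_zero (c : ℂ) : expSlope c 0 = sigma3 c := by
  have h1 : deriv (fun v => Complex.exp (c * v)) 0 = c := by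
    have := ((hasDerivAt_id (0 : ℂ)).const_mul c).cexp
    simpa using this.deriv
  have h2 : deriv (fun v => Complex.exp (-(c * v))) 0 = -c := by
    have := ((hasDerivAt_id (0 : ℂ)).const_mul c).neg.cexp
    simpa using this.deriv
  simp [expSlope, sigma3, h1, h2]

/-- For 2 × 2 matrices the adjugate is linear and fixes 1. First order expansions thus pass to
inverses of unimodular matrices without a quadratic remainder. -/
theorem adjugate_sub_one (A : Mat) : adjugate A - 1 = adjugate (A - 1) := by
  ext i j
  fin_cases i <;> fin_cases j <;> simp [Matrix.adjugate_fin_two]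

theorem smul_adjugate (c : ℂ) (A : Mat) : c • adjugate A = adjugate (c • A) := by
  ext i j
  fin_cases i <;> fin_cases j <;> simp [Matrix.adjugate_fin_two]

theorem adjugate_eq_neg_of_trace {A : Mat} (h : A.trace = 0) : adjugate A = -A := by
  rw [Matrix.trace_fin_two] at h
  ext i j
  fin_cases i <;> fin_cases j <;> simp [Matrix.adjugate_fin_two]
  · linear_combination h
  · linear_combination h

theorem tendsto_inv_zero_offRealInfty : Tendsto (fun z : ℂ => z⁻¹) offRealInfty (𝓝 0) :=
  tendsto_inv_offRealInfty.mono_right nhdsWithin_le_nhds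

theorem eventually_mem_offReal : ∀ᶠ z in offRealInfty, z ∈ offReal :=
  mem_inf_of_right (mem_principal_self _)

theorem tendsto_one_of_tendsto_smul_sub_one {A : Type*} {l : Filter A} {N : A → ℂ → Mat} {L : Mat}
    (hN : Tendsto (fun p : ℂ × A => p.1 • (N p.2 p.1 - 1)) (offRealInfty ×ˢ l) (𝓝 L)) :
    Tendsto (fun p : ℂ × A => N p.2 p.1) (offRealInfty ×ˢ l) (𝓝 1) := by
  have h1 := ((tendsto_inv_zero_offRealInfty.comp (tendsto_fst (g := l))).smul hN).add_const (1 : Mat)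
  rw [zero_smul, zero_add] at h1
  refine h1.congr' ?_
  filter_upwards [eventually_mem_offReal.prod_inl l] with p hp
  have h0 := SpectralData.ne_zero_of_mem_offReal hp
  simp [smul_smul, h0]

/-- First order version of `tendsto_of_tendsto_offRealInfty`: the family is differentiable in the
rate `δ` of the twist. -/
theorem tendsto_inv_smul_sub_one {A : Type*} {l : Filter A} {δ : A → ℝ}
    (hδ : Tendsto δ l (𝓝[≠] 0)) {E N' N : A → ℂ → Mat} {c : ℂ} {L : Mat}
    (hE : ∀ᶠ a in l, IsEntire (E a))
    (hEN : ∀ᶠ p : ℂ × A in offRealInfty ×ˢ l,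
      E p.2 p.1 = N' p.2 p.1 * expSigma3 (c * (δ p.2 * p.1)) * adjugate (N p.2 p.1))
    (hN' : Tendsto (fun p : ℂ × A => p.1 • (N' p.2 p.1 - 1)) (offRealInfty ×ˢ l) (𝓝 L))
    (hN : Tendsto (fun p : ℂ × A => p.1 • (N p.2 p.1 - 1)) (offRealInfty ×ˢ l) (𝓝 L))
    (hL : L.trace = 0) (z : ℂ) :
    Tendsto (fun a => (δ a : ℂ)⁻¹ • (E a z - 1)) l
      (𝓝 (z • sigma3 c + (L * sigma3 c - sigma3 c * L))) := by
  have hδne : ∀ᶠ a in l, (δ a : ℂ) ≠ 0 := by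
    filter_upwards [hδ.eventually self_mem_nhdsWithin] with a ha
    exact_mod_cast ha
  set h : ℂ → Mat := fun w => L * expSlope c w - expSlope c w * L with hh
  have hcont : Continuous h :=
    (continuous_const.mul (continuous_expSlope c)).sub
      ((continuous_expSlope c).mul continuous_const)
  have hdiff : IsEntire h := by
    intro i j
    have := fun i j => isEntire_expSlope c i j
    simp only [hh, Matrix.sub_apply, Matrix.mul_apply, Fin.sum_univ_two]
    fun_prop
  have hdiffE : IsEntire fun w => expSigma3 (c * w) := by
    intro i j
    fin_cases i <;> fin_cases j <;> simp [expSigma3] <;> fun_prop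
  have hsphere : ∀ w ∈ Metric.sphere (0 : ℂ) 1,
      Tendsto (fun p : A × ℂ => (δ p.1 : ℂ)⁻¹ • (E p.1 (p.2 / δ p.1) - expSigma3 (c * p.2)))
        (l ×ˢ 𝓝[offReal] w) (𝓝 (h w)) := by
    intro w hw
    have hw0 : w ≠ 0 := by
      rintro rfl
      simp at hw
    have hT : Tendsto (fun p : A × ℂ => (p.2 / δ p.1, p.1)) (l ×ˢ 𝓝[offReal] w)
        (offRealInfty ×ˢ l) := (tendsto_div_offRealInfty hδ hw0).prodMk tendsto_fst
    have hsnd : Tendsto (fun p : A × ℂ => p.2) (l ×ˢ 𝓝[offReal] w) (𝓝 w) :=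
      tendsto_snd.mono_right nhdsWithin_le_nhds
    have hexp : Tendsto (fun p : A × ℂ => expSigma3 (c * p.2)) (l ×ˢ 𝓝[offReal] w)
        (𝓝 (expSigma3 (c * w))) :=
      (continuous_expSigma3.tendsto _).comp (hsnd.const_mul c)
    have hN1 := (tendsto_one_of_tendsto_smul_sub_one hN).comp hT
    have hadj : Tendsto (fun p : ℂ × A => p.1 • (adjugate (N p.2 p.1) - 1)) (offRealInfty ×ˢ l)
        (𝓝 (-L)) := by
      rw [← adjugate_eq_neg_of_trace hL]
      refine ((continuous_adjugate.tendsto _).comp hN).congr fun p => ?_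
      rw [adjugate_sub_one, smul_adjugate]
      rfl
    have hlim := (hsnd.inv₀ hw0).smul
      ((((hN'.comp hT).mul hexp).mul ((continuous_adjugate.tendsto _).comp hN1)).add
        (hexp.mul (hadj.comp hT)))
    -- The identity part of the exponential commutes with `L`. Only (exp(cwσ₃) - 1)/w remains in the
    -- commutator, so the limit on the circle extends holomorphically to w = 0.
    have hval : w⁻¹ • (L * expSigma3 (c * w) * adjugate 1 + expSigma3 (c * w) * -L) = h w := by
      have : expSigma3 (c * w) = w • expSlope c w + 1 := by
        rw [smul_expSlope, sub_add_cancel]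
      rw [this, adjugate_one]
      simp only [hh, mul_one, mul_add, add_mul, one_mul, mul_neg, Matrix.mul_smul, Matrix.smul_mul]
      rw [show w • (L * expSlope c w) + L + -(w • (expSlope c w * L) + L) =
        w • (L * expSlope c w - expSlope c w * L) by rw [smul_sub]; abel,
        smul_smul, inv_mul_cancel₀ hw0, one_smul]
    rw [hval] at hlim
    refine hlim.congr' ?_
    have hwne : ∀ᶠ v in 𝓝[offReal] w, v ≠ 0 :=
      eventually_nhdsWithin_of_forall fun v hv => SpectralData.ne_zero_of_mem_offReal hv
    filter_upwards [hT.eventually hEN, hδne.prod_mk hwne] with p hp hp0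
    obtain ⟨hp1, hp2⟩ := hp0
    simp only [Function.comp] at hp ⊢
    rw [hp, mul_div_cancel₀ _ hp1]
    generalize expSigma3 (c * p.2) = C
    generalize N' p.1 (p.2 / δ p.1) = U
    generalize adjugate (N p.1 (p.2 / δ p.1)) = V
    -- The factor 1/δ is w⁻¹ times the large argument w/δ, and the latter is what the first order
    -- expansions of `N'` and `N` require.
    have hz : p.2⁻¹ * (p.2 / δ p.1) = (δ p.1 : ℂ)⁻¹ := by
      field_simp
    simp only [Matrix.smul_mul, Matrix.mul_smul, ← smul_add, smul_smul, hz]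
    congr 1
    noncomm_ring
  have hδ0 : Tendsto (fun a => (δ a : ℂ) * z) l (𝓝 0) := by
    have := (Complex.continuous_ofReal.tendsto 0).comp (hδ.mono_right nhdsWithin_le_nhds)
    simpa using this.mul_const z
  have key : Tendsto (fun a => (δ a : ℂ)⁻¹ • (E a z - expSigma3 (c * (δ a * z))) -
      h (δ a * z)) l (𝓝 0) := by
    refine tendsto_mat_iff.2 fun i j => ?_
    have := tendsto_zero_of_tendsto_sphere (l := l)
      (H := fun a w => ((δ a : ℂ)⁻¹ • (E a (w / δ a) - expSigma3 (c * w)) - h w) i j)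
      (v := fun a => δ a * z) (R := 1)
      (by
        filter_upwards [hE] with a ha
        have h1 := ha i j
        have h2 := hdiff i j
        have h3 := hdiffE i j
        have h4 : Differentiable ℂ fun w : ℂ => E a (w / δ a) i j :=
          (ha i j).comp (by fun_prop : Differentiable ℂ fun w : ℂ => w / δ a)
        simp only [Matrix.sub_apply, Matrix.smul_apply, smul_eq_mul]
        exact ((h4.sub h3).const_mul _).sub h2)
      one_pos
      (by
        intro w hw
        have h2 := ((hcont.tendsto w).mono_left nhdsWithin_le_nhds).comp
            (tendsto_snd (f := l) (g := 𝓝[offReal] w))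
        have h3 := (hsphere w hw).sub h2
        rw [sub_self] at h3
        exact tendsto_mat_iff.1 h3 i j)
      (hδ0.eventually (Metric.closedBall_mem_nhds 0 one_pos))
    refine this.congr' ?_
    filter_upwards [hδne] with a ha
    simp only [mul_div_cancel_left₀ z ha]
  have h1 := (hcont.tendsto 0).comp hδ0
  have h2 := (((continuous_expSlope c).tendsto 0).comp hδ0).const_smul z
  -- The difference quotient splits into that of exp(cδzσ₃), with limit z c σ₃, and the deviation of
  -- E from this exponential, with limit the commutator `h 0`.
  have h3 := h2.add (key.add h1)
  simp only [hh, expSlope_zero, zero_add] at h3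
  refine h3.congr' ?_
  filter_upwards [hδne] with a ha
  simp only [Function.comp, sub_add_cancel]
  have h4 : z • expSlope c (δ a * z) = (δ a : ℂ)⁻¹ • (expSigma3 (c * (δ a * z)) - 1) := by
    rw [← smul_expSlope, smul_smul, inv_mul_cancel_left₀ ha]
  rw [h4, ← smul_add]
  congr 1
  abel

/-! ### Entrywise derivatives of matrix functions -/

/-- Entrywise derivative of a matrix function of a real variable. -/
def HasMatDerivAt (f : ℝ → Mat) (f' : Mat) (s : ℝ) : Prop :=
  ∀ i j, HasDerivAt (fun s => f s i j) (f' i j) s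

namespace HasMatDerivAt

variable {f g : ℝ → Mat} {f' g' : Mat} {s : ℝ}

theorem mul (hf : HasMatDerivAt f f' s) (hg : HasMatDerivAt g g' s) :
    HasMatDerivAt (fun s => f s * g s) (f' * g s + f s * g') s := by
  intro i j
  simp only [Matrix.mul_apply, Matrix.add_apply, Fin.sum_univ_two]
  exact (((hf i 0).fun_mul (hg 0 j)).fun_add ((hf i 1).fun_mul (hg 1 j))).congr_deriv (by ring)

theorem adjugate (hf : HasMatDerivAt f f' s) :
    HasMatDerivAt (fun s => Matrix.adjugate (f s)) (Matrix.adjugate f') s := by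
  intro i j
  simp only [Matrix.adjugate_fin_two]
  fin_cases i <;> fin_cases j <;> simp
  exacts [hf 1 1, (hf 0 1).fun_neg, (hf 1 0).fun_neg, hf 0 0]

theorem const (A : Mat) (s : ℝ) : HasMatDerivAt (fun _ => A) 0 s :=
  fun i j => hasDerivAt_const s (A i j)

theorem congr_of_eventuallyEq (hf : HasMatDerivAt f f' s) (h : ∀ᶠ r in 𝓝 s, g r = f r) :
    HasMatDerivAt g f' s :=
  fun i j => (hf i j).congr_of_eventuallyEq (h.mono fun r hr => by simp only [hr])

theorem of_tendsto {A : Mat} (hs : f s = A)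
    (h : Tendsto (fun r => ((r - s : ℝ) : ℂ)⁻¹ • (f r - A)) (𝓝[≠] s) (𝓝 f')) :
    HasMatDerivAt f f' s := by
  intro i j
  rw [hasDerivAt_iff_tendsto_slope]
  refine (tendsto_mat_iff.1 h i j).congr fun r => ?_
  rw [slope, vsub_eq_sub, ← Complex.coe_smul]
  simp [hs]

theorem expSigma3 (c : ℂ) (s : ℝ) :
    HasMatDerivAt (fun r => ShortPulse.expSigma3 (c * ((r - s : ℝ) : ℂ))) (sigma3 c) s := by
  have h0 : HasDerivAt (fun r : ℝ => c * ((r - s : ℝ) : ℂ)) c s := by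
    have := (((hasDerivAt_id s).sub_const s).ofReal_comp).const_mul c
    simpa using this
  intro i j
  fin_cases i <;> fin_cases j <;> simp only [ShortPulse.expSigma3, sigma3]
  · simpa using h0.cexp
  · simpa using hasDerivAt_const s (0 : ℂ)
  · simpa using hasDerivAt_const s (0 : ℂ)
  · simpa using h0.fun_neg.cexp

end HasMatDerivAt

/-! ### Symmetries of the Riemann-Hilbert problem -/

/-- Entrywise complex conjugation. -/
def conjMat (A : Mat) : Mat := !![star (A 0 0), star (A 0 1); star (A 1 0), star (A 1 1)]

/-- Complex conjugation followed by conjugation with the rotation by a right angle. -/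
def twistMat (A : Mat) : Mat := !![star (A 1 1), -star (A 1 0); -star (A 0 1), star (A 0 0)]

theorem continuous_conjMat : Continuous conjMat := by
  refine continuous_matrix fun i j => ?_
  have h : ∀ i j, Continuous fun A : Mat => star (A i j) := fun i j =>
    Complex.continuous_conj.comp (by fun_prop)
  fin_cases i <;> fin_cases j
  exacts [h 0 0, h 0 1, h 1 0, h 1 1]

theorem continuous_twistMat : Continuous twistMat := by
  refine continuous_matrix fun i j => ?_
  have h : ∀ i j, Continuous fun A : Mat => star (A i j) := fun i j =>
    Complex.continuous_conj.comp (by fun_prop)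
  fin_cases i <;> fin_cases j
  exacts [h 1 1, (h 1 0).neg, (h 0 1).neg, h 0 0]

theorem conjMat_mul (A B : Mat) : conjMat (A * B) = conjMat A * conjMat B := by
  ext i j
  fin_cases i <;> fin_cases j <;> simp [conjMat, Matrix.mul_apply, Fin.sum_univ_two]

theorem twistMat_mul (A B : Mat) : twistMat (A * B) = twistMat A * twistMat B := by
  ext i j
  fin_cases i <;> fin_cases j <;> simp [twistMat, Matrix.mul_apply, Fin.sum_univ_two] <;> ring

theorem conjMat_sub (A B : Mat) : conjMat (A - B) = conjMat A - conjMat B := by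
  ext i j
  fin_cases i <;> fin_cases j <;> simp [conjMat]

theorem twistMat_sub (A B : Mat) : twistMat (A - B) = twistMat A - twistMat B := by
  ext i j
  fin_cases i <;> fin_cases j <;> simp [twistMat] <;> ring

theorem conjMat_smul (c : ℂ) (A : Mat) : conjMat (c • A) = star c • conjMat A := by
  ext i j
  fin_cases i <;> fin_cases j <;> simp [conjMat]

theorem twistMat_smul (c : ℂ) (A : Mat) : twistMat (c • A) = star c • twistMat A := by
  ext i j
  fin_cases i <;> fin_cases j <;> simp [twistMat]

@[simp]
theorem conjMat_one : conjMat 1 = 1 := by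
  ext i j
  fin_cases i <;> fin_cases j <;> simp [conjMat]

@[simp]
theorem twistMat_one : twistMat 1 = 1 := by
  ext i j
  fin_cases i <;> fin_cases j <;> simp [twistMat]

theorem conjMat_adjugate (A : Mat) : conjMat (adjugate A) = adjugate (conjMat A) := by
  ext i j
  fin_cases i <;> fin_cases j <;> simp [conjMat, Matrix.adjugate_fin_two]

theorem twistMat_adjugate (A : Mat) : twistMat (adjugate A) = adjugate (twistMat A) := by
  ext i j
  fin_cases i <;> fin_cases j <;> simp [twistMat, Matrix.adjugate_fin_two]

theorem conjMat_expSigma3 (c : ℂ) : conjMat (expSigma3 c) = expSigma3 (star c) := by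
  ext i j
  fin_cases i <;> fin_cases j <;> simp [conjMat, expSigma3, ← Complex.exp_conj]

theorem twistMat_expSigma3 (c : ℂ) : twistMat (expSigma3 c) = expSigma3 (-star c) := by
  ext i j
  fin_cases i <;> fin_cases j <;> simp [twistMat, expSigma3, ← Complex.exp_conj]

theorem star_mem_offReal {z : ℂ} (hz : z ∈ offReal) : star z ∈ offReal := by
  simpa [offReal] using hz

theorem neg_star_mem_offReal {z : ℂ} (hz : z ∈ offReal) : -star z ∈ offReal := by
  simpa [offReal] using hz

theorem continuous_star_complex : Continuous (star : ℂ → ℂ) := Complex.continuous_conj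

theorem tendsto_star_nhdsWithin {s s' : Set ℂ} {p : ℂ} (h : ∀ z ∈ s, star z ∈ s') :
    Tendsto (fun z : ℂ => star z) (𝓝[s] p) (𝓝[s'] (star p)) :=
  tendsto_nhdsWithin_iff.2 ⟨(continuous_star_complex.tendsto p).mono_left nhdsWithin_le_nhds,
    eventually_nhdsWithin_of_forall h⟩

theorem tendsto_neg_star_nhdsWithin {s s' : Set ℂ} {p : ℂ} (h : ∀ z ∈ s, -star z ∈ s') :
    Tendsto (fun z : ℂ => -star z) (𝓝[s] p) (𝓝[s'] (-star p)) :=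
  tendsto_nhdsWithin_iff.2
    ⟨(continuous_star_complex.neg.tendsto p).mono_left nhdsWithin_le_nhds,
      eventually_nhdsWithin_of_forall h⟩

theorem tendsto_star_offRealInfty : Tendsto (fun z : ℂ => star z) offRealInfty offRealInfty := by
  refine tendsto_inf.2 ⟨?_, tendsto_principal.2 ?_⟩
  · rw [← Metric.cobounded_eq_cocompact, ← tendsto_norm_atTop_iff_cobounded]
    simp only [norm_star]
    exact (tendsto_norm_atTop_iff_cobounded.2 tendsto_id).mono_left
      (Metric.cobounded_eq_cocompact (α := ℂ) ▸ inf_le_left)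
  · filter_upwards [eventually_mem_offReal] with z hz using star_mem_offReal hz

theorem tendsto_neg_star_offRealInfty :
    Tendsto (fun z : ℂ => -star z) offRealInfty offRealInfty := by
  refine tendsto_inf.2 ⟨?_, tendsto_principal.2 ?_⟩
  · rw [← Metric.cobounded_eq_cocompact, ← tendsto_norm_atTop_iff_cobounded]
    simp only [norm_neg, norm_star]
    exact (tendsto_norm_atTop_iff_cobounded.2 tendsto_id).mono_left
      (Metric.cobounded_eq_cocompact (α := ℂ) ▸ inf_le_left)
  · filter_upwards [eventually_mem_offReal] with z hz using neg_star_mem_offReal hz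

theorem differentiableAt_star_star {f : ℂ → ℂ} {z : ℂ} (h : DifferentiableAt ℂ f (star z)) :
    DifferentiableAt ℂ (fun z => star (f (star z))) z := by
  have := h.conj_conj
  simp only [Complex.star_def, Complex.conj_conj] at this
  exact this

theorem differentiableAt_star_neg_star {f : ℂ → ℂ} {z : ℂ} (h : DifferentiableAt ℂ f (-star z)) :
    DifferentiableAt ℂ (fun z => star (f (-star z))) z :=
  differentiableAt_star_star (f := fun z => f (-z)) (h.comp (star z) differentiableAt_id.neg)

theorem star_phase (x t : ℝ) (z : ℂ) : star (phase x t z) = -phase x t (star z) := by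
  simp only [phase, Complex.star_def, map_add, map_mul, map_div₀, Complex.conj_I,
    Complex.conj_ofReal, map_ofNat]
  rw [mul_neg, neg_mul, neg_mul (4 * Complex.I), div_neg]
  ring

theorem phase_neg (x t : ℝ) (z : ℂ) : phase x t (-z) = -phase x t z := by
  simp only [phase, mul_neg, neg_mul, div_neg]
  ring

namespace SpectralData

variable {D : SpectralData} {x t : ℝ} {M : ℂ → Mat}

/-- `twistMat` is the adjoint of the adjugate. On the real line the phase is imaginary, so the jump
matrix is Hermitian with determinant 1 and its twist is its inverse. -/
theorem twistMat_J_mul_J (D : SpectralData) (x t s : ℝ) : twistMat (D.J x t s) * D.J x t s = 1 := by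
  have h0 : twistMat (D.J0 s) * D.J0 s = 1 := by
    have := Complex.conj_mul' (D.r s)
    ext i j
    fin_cases i <;> fin_cases j <;>
      simp [twistMat, J0, Matrix.mul_apply, Fin.sum_univ_two] <;>
      first | ring1 | linear_combination this | linear_combination -this
  have hph : star (phase x t s) = -phase x t s := by
    rw [star_phase, Complex.star_def, Complex.conj_ofReal]
  rw [J_eq, twistMat_mul, twistMat_mul, twistMat_expSigma3, twistMat_expSigma3, star_neg, hph]
  simp only [neg_neg]
  generalize phase x t s = a
  calc _ = expSigma3 (-a) * (twistMat (D.J0 s) * (expSigma3 a * expSigma3 (-a)) * D.J0 s) *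
        expSigma3 a := by simp only [Matrix.mul_assoc]
    _ = 1 := by
      rw [expSigma3_mul, add_neg_cancel, expSigma3_zero, Matrix.mul_one, h0, Matrix.mul_one,
        expSigma3_mul, neg_add_cancel, expSigma3_zero]

theorem conjMat_J_neg (D : SpectralData) (x t s : ℝ) : conjMat (D.J x t (-s)) = D.J x t s := by
  have h0 : conjMat (D.J0 (-s)) = D.J0 s := by
    have h1 := D.r_symm s
    ext i j
    fin_cases i <;> fin_cases j <;> simp [conjMat, J0, ← h1]
  have hph : star (phase x t ((-s : ℝ) : ℂ)) = phase x t s := by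
    rw [star_phase, Complex.star_def, Complex.conj_ofReal, Complex.ofReal_neg, phase_neg, neg_neg]
  rw [J_eq, conjMat_mul, conjMat_mul, conjMat_expSigma3, conjMat_expSigma3, star_neg, hph, h0, J_eq]

namespace IsRHSolution

theorem differentiableAt_fst (h : D.IsRHSolution x t M) {z : ℂ}
    (hz : z ∈ offReal \ Set.range D.k) (i : Fin 2) :
    DifferentiableAt ℂ (fun z => M z i 0) z :=
  (h.holo_fst i).differentiableAt (D.isOpen_fst.mem_nhds hz)

theorem differentiableAt_snd (h : D.IsRHSolution x t M) {z : ℂ}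
    (hz : z ∈ offReal \ Set.range fun j => star (D.k j)) (i : Fin 2) :
    DifferentiableAt ℂ (fun z => M z i 1) z :=
  (h.holo_snd i).differentiableAt (D.isOpen_snd.mem_nhds hz)

/-- Reflection in the real axis exchanges the half-planes, and the twist exchanges the columns, so
the poles at `k j` and at their conjugates trade places and the two residue conditions go over into
each other. -/
theorem twist (h : D.IsRHSolution x t M) :
    D.IsRHSolution x t fun z => twistMat (M (star z)) where
  holo_fst i := by
    intro z hz
    have hz' : star z ∈ offReal \ Set.range fun j => star (D.k j) := by
      refine ⟨star_mem_offReal hz.1, ?_⟩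
      rintro ⟨j, hj⟩
      exact hz.2 ⟨j, star_injective hj⟩
    refine DifferentiableAt.differentiableWithinAt ?_
    fin_cases i
    · exact differentiableAt_star_star (h.differentiableAt_snd hz' 1)
    · exact (differentiableAt_star_star (h.differentiableAt_snd hz' 0)).neg
  holo_snd i := by
    intro z hz
    have hz' : star z ∈ offReal \ Set.range D.k := by
      refine ⟨star_mem_offReal hz.1, ?_⟩
      rintro ⟨j, hj⟩
      exact hz.2 ⟨j, by simp [hj]⟩
    refine DifferentiableAt.differentiableWithinAt ?_
    fin_cases i
    · exact (differentiableAt_star_star (h.differentiableAt_fst hz' 1)).neg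
    · exact differentiableAt_star_star (h.differentiableAt_fst hz' 0)
  res_fst j i := by
    have hT : Tendsto (fun z : ℂ => star z) (𝓝[≠] (D.k j)) (𝓝[≠] (star (D.k j))) :=
      tendsto_star_nhdsWithin fun z hz h => hz (star_injective h)
    have key := fun i => (continuous_star_complex.tendsto _).comp ((h.res_snd j i).comp hT)
    have hexp : star (Complex.exp
        (-2 * Complex.I * (star (D.k j) * x - t / (4 * star (D.k j))))) =
        Complex.exp (2 * Complex.I * (D.k j * x - t / (4 * D.k j))) := by
      rw [Complex.star_def, ← Complex.exp_conj]
      simp [Complex.conj_ofNat]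
    fin_cases i
    · convert key 1 using 1
      · ext z
        simp [twistMat]
      · simp only [star_mul', hexp]
        simp [twistMat]
    · convert (key 0).neg using 1
      · ext z
        simp [twistMat]
      · simp only [star_mul', hexp]
        simp [twistMat]
  res_snd j i := by
    have hT : Tendsto (fun z : ℂ => star z) (𝓝[≠] (star (D.k j))) (𝓝[≠] (D.k j)) := by
      have := tendsto_star_nhdsWithin (s := {star (D.k j)}ᶜ) (s' := {D.k j}ᶜ) (p := star (D.k j))
        fun z hz h => hz (by
          have h' : star z = D.k j := h
          rw [← h', star_star]
          rfl)
      rwa [star_star] at this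
    have key := fun i => (continuous_star_complex.tendsto _).comp ((h.res_fst j i).comp hT)
    have hexp : star (Complex.exp (2 * Complex.I * (D.k j * x - t / (4 * D.k j)))) =
        Complex.exp (-2 * Complex.I * (star (D.k j) * x - t / (4 * star (D.k j)))) := by
      rw [Complex.star_def, ← Complex.exp_conj]
      simp [Complex.conj_ofNat]
    fin_cases i
    · convert (key 1).neg using 1
      · ext z
        simp [twistMat]
      · simp only [star_mul', hexp]
        simp [twistMat]
    · convert key 0 using 1
      · ext z
        simp [twistMat]
      · simp only [star_mul', hexp]
        simp [twistMat]
  jump := by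
    obtain ⟨Mp, Mm, hJ⟩ := h.jump
    -- The boundary values change sides, so the jump relation must be inverted.
    refine ⟨fun s => twistMat (Mm s), fun s => twistMat (Mp s), fun s => ⟨?_, ?_, fun hs => ?_⟩⟩
    · have hT := tendsto_star_nhdsWithin (s := {z | 0 < z.im}) (s' := {z | z.im < 0}) (p := s)
        fun z hz => by simpa using hz
      rw [Complex.star_def, Complex.conj_ofReal] at hT
      exact (continuous_twistMat.tendsto _).comp ((hJ s).2.1.comp hT)
    · have hT := tendsto_star_nhdsWithin (s := {z | z.im < 0}) (s' := {z | 0 < z.im}) (p := s)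
        fun z hz => by simpa using hz
      rw [Complex.star_def, Complex.conj_ofReal] at hT
      exact (continuous_twistMat.tendsto _).comp ((hJ s).1.comp hT)
    · beta_reduce
      rw [(hJ s).2.2 hs, twistMat_mul, Matrix.mul_assoc, twistMat_J_mul_J, Matrix.mul_one]
  norm_infty := by
    have := (continuous_twistMat.tendsto _).comp (h.norm_infty.comp tendsto_star_offRealInfty)
    rwa [twistMat_one] at this

/-- The map z ↦ -conj z preserves each half-plane and permutes the points `k j` according to
`k_symm`; `r_symm` matches the jumps at s and -s. -/
theorem conj (h : D.IsRHSolution x t M) :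
    D.IsRHSolution x t fun z => conjMat (M (-star z)) where
  holo_fst i := by
    intro z hz
    have hz' : -star z ∈ offReal \ Set.range D.k := by
      refine ⟨neg_star_mem_offReal hz.1, ?_⟩
      rintro ⟨j, hj⟩
      obtain ⟨l, hl, -⟩ := D.k_symm j
      exact hz.2 ⟨l, by rw [hl, hj]; simp⟩
    refine DifferentiableAt.differentiableWithinAt ?_
    fin_cases i
    · exact differentiableAt_star_neg_star (h.differentiableAt_fst hz' 0)
    · exact differentiableAt_star_neg_star (h.differentiableAt_fst hz' 1)
  holo_snd i := by
    intro z hz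
    have hz' : -star z ∈ offReal \ Set.range fun j => star (D.k j) := by
      refine ⟨neg_star_mem_offReal hz.1, ?_⟩
      rintro ⟨j, hj⟩
      obtain ⟨l, hl, -⟩ := D.k_symm j
      refine hz.2 ⟨l, ?_⟩
      beta_reduce at hj ⊢
      rw [hl, hj]
      simp
    refine DifferentiableAt.differentiableWithinAt ?_
    fin_cases i
    · exact differentiableAt_star_neg_star (h.differentiableAt_snd hz' 0)
    · exact differentiableAt_star_neg_star (h.differentiableAt_snd hz' 1)
  res_fst j i := by
    obtain ⟨l, hl, hγ⟩ := D.k_symm j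
    have hk : D.k j = -star (D.k l) := by simp [hl]
    have hγ' : star (D.γ l) = D.γ j := by rw [hγ, star_star]
    have hT : Tendsto (fun z : ℂ => -star z) (𝓝[≠] (D.k j)) (𝓝[≠] (D.k l)) := by
      rw [hl]
      exact tendsto_neg_star_nhdsWithin fun z hz h => hz (star_injective (neg_injective h))
    -- The sign compensates the conjugate of `I` on one side and the orientation of z ↦ -conj z,
    -- which sends `z - k j` to minus a conjugate, on the other.
    have key := ((continuous_star_complex.tendsto _).comp ((h.res_fst l i).comp hT)).neg
    have hexp : star (Complex.exp (2 * Complex.I * (D.k l * x - t / (4 * D.k l)))) =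
        Complex.exp (2 * Complex.I * (D.k j * x - t / (4 * D.k j))) := by
      rw [Complex.star_def, ← Complex.exp_conj, hl]
      simp [div_neg, Complex.conj_ofNat]
      ring_nf
    convert key using 1
    · ext z
      fin_cases i <;> simp [conjMat, hl] <;> ring
    · simp only [star_mul', hexp, hγ', ← hl]
      fin_cases i <;> simp [conjMat]
  res_snd j i := by
    obtain ⟨l, hl, hγ⟩ := D.k_symm j
    have hγ' : star (star (D.γ l)) = star (D.γ j) := by rw [hγ, star_star]
    have hT : Tendsto (fun z : ℂ => -star z) (𝓝[≠] (star (D.k j))) (𝓝[≠] (star (D.k l))) := by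
      have := tendsto_neg_star_nhdsWithin (s := {star (D.k j)}ᶜ) (s' := {-star (star (D.k j))}ᶜ)
        (p := star (D.k j)) fun z hz h => hz (star_injective (neg_injective h))
      rw [hl, star_neg]
      exact this
    have key := ((continuous_star_complex.tendsto _).comp ((h.res_snd l i).comp hT)).neg
    have hexp : star (Complex.exp
        (-2 * Complex.I * (star (D.k l) * x - t / (4 * star (D.k l))))) =
        Complex.exp (-2 * Complex.I * (star (D.k j) * x - t / (4 * star (D.k j)))) := by
      rw [Complex.star_def, ← Complex.exp_conj, hl]
      simp [div_neg, Complex.conj_ofNat]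
      ring_nf
    have hkl : -star (star (D.k j)) = star (D.k l) := by simp [hl]
    convert key using 1
    · ext z
      fin_cases i <;> simp [conjMat, hl] <;> ring
    · simp only [star_mul', hexp, hγ', hkl]
      fin_cases i <;> simp [conjMat]
  jump := by
    obtain ⟨Mp, Mm, hJ⟩ := h.jump
    refine ⟨fun s => conjMat (Mp (-s)), fun s => conjMat (Mm (-s)),
      fun s => ⟨?_, ?_, fun hs => ?_⟩⟩
    · have hT := tendsto_neg_star_nhdsWithin (s := {z | 0 < z.im}) (s' := {z | 0 < z.im}) (p := s)
        fun z hz => by simpa using hz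
      rw [Complex.star_def, Complex.conj_ofReal, ← Complex.ofReal_neg] at hT
      exact (continuous_conjMat.tendsto _).comp ((hJ (-s)).1.comp hT)
    · have hT := tendsto_neg_star_nhdsWithin (s := {z | z.im < 0}) (s' := {z | z.im < 0}) (p := s)
        fun z hz => by simpa using hz
      rw [Complex.star_def, Complex.conj_ofReal, ← Complex.ofReal_neg] at hT
      exact (continuous_conjMat.tendsto _).comp ((hJ (-s)).2.1.comp hT)
    · beta_reduce
      rw [(hJ (-s)).2.2 (neg_ne_zero.2 hs), conjMat_mul, conjMat_J_neg]
  norm_infty := by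
    have := (continuous_conjMat.tendsto _).comp (h.norm_infty.comp tendsto_neg_star_offRealInfty)
    rwa [conjMat_one] at this

end IsRHSolution

end SpectralData

/-! ### Consequences of uniqueness for the expansion coefficients -/

theorem conjMat_symm_re {A : Mat} (h : conjMat A = A) (i j : Fin 2) : ((A i j).re : ℂ) = A i j := by
  have h1 : star (A i j) = A i j := by
    conv_rhs => rw [← h]
    fin_cases i <;> fin_cases j <;> simp [conjMat]
  exact Complex.conj_eq_iff_re.1 h1

theorem adjugate_mul_self {A : Mat} (h : A.det = 1) : adjugate A * A = 1 := by
  rw [adjugate_mul, h, one_smul]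

theorem mul_adjugate_self {A : Mat} (h : A.det = 1) : A * adjugate A = 1 := by
  rw [mul_adjugate, h, one_smul]

theorem inv_eq_adjugate {A : Mat} (h : A.det = 1) : A⁻¹ = adjugate A := by
  rw [Matrix.inv_def, h]
  simp

/-- Local uniformity is a joint limit of the difference only. The limit function is not yet known to
be continuous, or even locally bounded, in the parameters, hence the subtraction. -/
theorem tendsto_uncurry_sub {l : Filter ℂ} {s : Set (ℝ × ℝ)} {F : ℂ → ℝ × ℝ → Mat}
    {f : ℝ × ℝ → Mat} (h : TendstoLocallyUniformlyOn F f l s) (hs : IsOpen s) {p : ℝ × ℝ}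
    (hp : p ∈ s) : Tendsto (fun q : ℂ × (ℝ × ℝ) => F q.1 q.2 - f q.2) (l ×ˢ 𝓝 p) (𝓝 0) := by
  have h1 := tendstoUniformlyOnFilter_iff_tendsto.1 (tendstoLocallyUniformlyOn_iff_filter.1 h p hp)
  rw [hs.nhdsWithin_eq hp] at h1
  refine tendsto_mat_iff.2 fun i j => ?_
  have h2 : UniformContinuous fun A : Mat => A i j :=
    (Pi.uniformContinuous_proj (fun _ : Fin 2 => ℂ) j).comp
      (Pi.uniformContinuous_proj (fun _ : Fin 2 => Fin 2 → ℂ) i)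
  have h3 := Tendsto.comp h2 h1
  rw [uniformity_eq_comap_nhds_zero, tendsto_comap_iff] at h3
  exact h3

theorem tendsto_uncurry {l : Filter ℂ} {s : Set (ℝ × ℝ)} {F : ℂ → ℝ × ℝ → Mat}
    {f : ℝ × ℝ → Mat} (h : TendstoLocallyUniformlyOn F f l s) (hs : IsOpen s) {p : ℝ × ℝ}
    (hp : p ∈ s) (hf : ContinuousAt f p) :
    Tendsto (fun q : ℂ × (ℝ × ℝ) => F q.1 q.2) (l ×ˢ 𝓝 p) (𝓝 (f p)) := by
  have := (tendsto_uncurry_sub h hs hp).add (hf.tendsto.comp (tendsto_snd (f := l)))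
  simpa using this

namespace SpectralData

variable {D : SpectralData} {I : Set ℝ} {M : ℝ → ℝ → ℂ → Mat}

namespace IsUniqueRHFamily

theorem twist_eq (hM : D.IsUniqueRHFamily I M) (y : ℝ) {t : ℝ} (ht : t ∈ I) :
    ∀ z ∈ D.regular, twistMat (M y t (star z)) = M y t z :=
  (hM y t ht).2 _ (hM y t ht).1.twist

theorem conj_eq (hM : D.IsUniqueRHFamily I M) (y : ℝ) {t : ℝ} (ht : t ∈ I) :
    ∀ z ∈ D.regular, conjMat (M y t (-star z)) = M y t z :=
  (hM y t ht).2 _ (hM y t ht).1.conj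

end IsUniqueRHFamily

end SpectralData

theorem tendsto_star_zero : Tendsto (fun z : ℂ => star z) (𝓝[offReal] 0) (𝓝[offReal] 0) := by
  have := tendsto_star_nhdsWithin (p := 0) fun z hz => star_mem_offReal hz
  simpa only [star_zero] using this

theorem tendsto_neg_star_zero : Tendsto (fun z : ℂ => -star z) (𝓝[offReal] 0) (𝓝[offReal] 0) := by
  have := tendsto_neg_star_nhdsWithin (p := 0) fun z hz => neg_star_mem_offReal hz
  simpa only [star_zero, neg_zero] using this

section Family

variable {D : SpectralData} {I : Set ℝ} {M : ℝ → ℝ → ℂ → Mat}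

namespace HasExpansions

theorem tendsto_atZero (hexp : HasExpansions I M) (y : ℝ) {t : ℝ} (ht : t ∈ I) :
    Tendsto (M y t) (𝓝[offReal] 0) (𝓝 (atZero (M y t))) :=
  hexp.zero_zeroth.tendsto_at (a := (y, t)) ⟨trivial, ht⟩

theorem tendsto_slopeAtZero (hexp : HasExpansions I M) (y : ℝ) {t : ℝ} (ht : t ∈ I) :
    Tendsto (fun k => (Complex.I / k) • ((atZero (M y t))⁻¹ * M y t k - 1)) (𝓝[offReal] 0)
      (𝓝 (slopeAtZero (M y t))) :=
  hexp.zero_first.tendsto_at (a := (y, t)) ⟨trivial, ht⟩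

variable (hexp : HasExpansions I M) (hM : D.IsUniqueRHFamily I M) (y : ℝ) {t : ℝ} (ht : t ∈ I)
include hexp hM ht

theorem det_atZero : (atZero (M y t)).det = 1 :=
  (hM y t ht).1.det_eq_one_of_tendsto (hexp.tendsto_atZero y ht)

theorem det_regular {z : ℂ} (hz : z ∈ D.regular) : (M y t z).det = 1 :=
  (hM y t ht).1.det_eq_one (hexp.tendsto_atZero y ht) hz

theorem conjMat_atZero : conjMat (atZero (M y t)) = atZero (M y t) := by
  have h := hexp.tendsto_atZero y ht
  refine tendsto_nhds_unique
    ((continuous_conjMat.tendsto _).comp (h.comp tendsto_neg_star_zero)) (h.congr' ?_)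
  filter_upwards [D.eventually_nhds_zero_regular] with z hz using (hM.conj_eq y ht z hz).symm

theorem twistMat_atZero : twistMat (atZero (M y t)) = atZero (M y t) := by
  have h := hexp.tendsto_atZero y ht
  refine tendsto_nhds_unique
    ((continuous_twistMat.tendsto _).comp (h.comp tendsto_star_zero)) (h.congr' ?_)
  filter_upwards [D.eventually_nhds_zero_regular] with z hz using (hM.twist_eq y ht z hz).symm

theorem conjMat_slopeAtZero : conjMat (slopeAtZero (M y t)) = slopeAtZero (M y t) := by
  have h := hexp.tendsto_slopeAtZero y ht
  refine tendsto_nhds_unique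
    ((continuous_conjMat.tendsto _).comp (h.comp tendsto_neg_star_zero)) (h.congr' ?_)
  filter_upwards [D.eventually_nhds_zero_regular] with z hz
  have h1 : star (Complex.I / -star z) = Complex.I / z := by
    simp [neg_div_neg_eq]
  simp only [Function.comp]
  rw [inv_eq_adjugate (hexp.det_atZero hM y ht), conjMat_smul, conjMat_sub, conjMat_mul,
    conjMat_adjugate, hexp.conjMat_atZero hM y ht, hM.conj_eq y ht z hz, conjMat_one, h1]

/-- The sign comes from the factor `I / k`, which changes sign under conjugation combined with k ↦
conj k, whereas it is invariant for k ↦ -conj k. -/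
theorem twistMat_slopeAtZero : twistMat (slopeAtZero (M y t)) = -slopeAtZero (M y t) := by
  have h := hexp.tendsto_slopeAtZero y ht
  refine tendsto_nhds_unique
    ((continuous_twistMat.tendsto _).comp (h.comp tendsto_star_zero)) (h.neg.congr' ?_)
  filter_upwards [D.eventually_nhds_zero_regular] with z hz
  have h1 : star (Complex.I / star z) = -(Complex.I / z) := by
    simp [neg_div]
  simp only [Function.comp]
  rw [inv_eq_adjugate (hexp.det_atZero hM y ht), twistMat_smul, twistMat_sub, twistMat_mul,
    twistMat_adjugate, hexp.twistMat_atZero hM y ht, hM.twist_eq y ht z hz, twistMat_one, h1,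
    neg_smul]

theorem atZero_eq : atZero (M y t) =
    !![(alpha M y t : ℂ), (beta M y t : ℂ); -(beta M y t : ℂ), (alpha M y t : ℂ)] := by
  have hc := hexp.conjMat_atZero hM y ht
  have hre := conjMat_symm_re hc
  have htw := hexp.twistMat_atZero hM y ht
  have h10 : atZero (M y t) 1 0 = -atZero (M y t) 0 1 := by
    conv_lhs => rw [← htw]
    conv_rhs => rw [← hc]
    rfl
  have h11 : atZero (M y t) 1 1 = atZero (M y t) 0 0 := by
    conv_lhs => rw [← htw]
    conv_rhs => rw [← hc]
    rfl
  ext i j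
  fin_cases i <;> fin_cases j
  · exact (hre 0 0).symm
  · exact (hre 0 1).symm
  · exact h10.trans (congrArg Neg.neg (hre 0 1).symm)
  · exact h11.trans (hre 0 0).symm

theorem slopeAtZero_eq : slopeAtZero (M y t) =
    !![(f1 M y t : ℂ), (f2 M y t : ℂ); (f2 M y t : ℂ), -(f1 M y t : ℂ)] := by
  have hc := hexp.conjMat_slopeAtZero hM y ht
  have hre := conjMat_symm_re hc
  have htw := hexp.twistMat_slopeAtZero hM y ht
  have h10 : slopeAtZero (M y t) 1 0 = slopeAtZero (M y t) 0 1 := by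
    rw [← neg_inj, ← Matrix.neg_apply, ← htw]
    conv_rhs => rw [← hc]
    rfl
  have h11 : slopeAtZero (M y t) 1 1 = -slopeAtZero (M y t) 0 0 := by
    rw [← neg_inj, ← Matrix.neg_apply, ← htw, neg_neg]
    conv_rhs => rw [← hc]
    rfl
  ext i j
  fin_cases i <;> fin_cases j
  · exact (hre 0 0).symm
  · exact (hre 0 1).symm
  · exact h10.trans (hre 0 1).symm
  · exact h11.trans (congrArg Neg.neg (hre 0 0).symm)

omit hexp in
-- One symmetry makes the entries of `L` imaginary, the other makes the diagonal entries conjugate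
-- to each other. Tracelessness is what allows adj M to have first coefficient `-L` at infinity.
theorem trace_eq_zero_of_tendsto {L : Mat}
    (hL : Tendsto (fun k => k • (M y t k - 1)) offRealInfty (𝓝 L)) : L.trace = 0 := by
  have hc : conjMat L = -L := by
    refine tendsto_nhds_unique
      ((continuous_conjMat.tendsto _).comp (hL.comp tendsto_neg_star_offRealInfty))
      (hL.neg.congr' ?_)
    filter_upwards [D.eventually_offRealInfty_regular] with z hz
    simp only [Function.comp]
    rw [conjMat_smul, conjMat_sub, hM.conj_eq y ht z hz, conjMat_one, star_neg, star_star, neg_smul]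
  have htw : twistMat L = L := by
    refine tendsto_nhds_unique
      ((continuous_twistMat.tendsto _).comp (hL.comp tendsto_star_offRealInfty))
      (hL.congr' ?_)
    filter_upwards [D.eventually_offRealInfty_regular] with z hz
    simp only [Function.comp]
    rw [twistMat_smul, twistMat_sub, hM.twist_eq y ht z hz, twistMat_one, star_star]
  have h1 : star (L 0 0) = -L 0 0 := congrFun (congrFun hc 0) 0
  have h2 : star (L 0 0) = L 1 1 := congrFun (congrFun htw 1) 1
  rw [Matrix.trace_fin_two, ← h2, h1, add_neg_cancel]

omit hM in
theorem tendsto_uncurry_infty (hI : IsOpen I) :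
    Tendsto (fun q : ℂ × (ℝ × ℝ) => M q.2.1 q.2.2 q.1) (offRealInfty ×ˢ 𝓝 (y, t)) (𝓝 1) :=
  tendsto_uncurry hexp.infty_zeroth (isOpen_univ.prod hI) (p := (y, t)) ⟨trivial, ht⟩
    continuousAt_const

omit hexp in
/-- The quotients of the solutions at different times, as functions of `ζ = 1 / k`. -/
theorem exists_entire_time : ∃ E : ℝ → ℂ → Mat, ∀ t' ∈ I, IsEntire (E t') ∧
    (∀ z ∈ D.regular, E t' z⁻¹ = M y t' z * expSigma3 (Complex.I / 4 * ((t' - t : ℝ) * z⁻¹)) *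
      adjugate (M y t z)) ∧ E t' 0 = 1 := by
  have : ∀ t' ∈ I, _ := fun t' ht' =>
    (hM y t ht).1.exists_entire_of_eq_space (hM y t' ht').1
  choose! E hE using this
  exact ⟨E, hE⟩

end HasExpansions

theorem tendsto_sub_nhdsNE (t : ℝ) : Tendsto (fun t' => t' - t) (𝓝[≠] t) (𝓝[≠] 0) := by
  refine tendsto_nhdsWithin_iff.2 ⟨?_, ?_⟩
  · have : Tendsto (fun t' : ℝ => t' - t) (𝓝 t) (𝓝 (t - t)) := (continuous_sub_right t).tendsto t
    rw [sub_self] at this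
    exact this.mono_left nhdsWithin_le_nhds
  · exact eventually_nhdsWithin_of_forall fun t' ht' => sub_ne_zero.2 ht'

theorem tendsto_prodMk_nhds (y t : ℝ) : Tendsto (fun t' : ℝ => (y, t')) (𝓝 t) (𝓝 (y, t)) :=
  (Continuous.prodMk_right y).tendsto t

theorem exists_ultrafilter_tendsto {A : Type*} (U : Ultrafilter A) {f : A → ℂ}
    (hf : ∀ a, ‖f a‖ ≤ 1) : ∃ b, Tendsto f U (𝓝 b) := by
  obtain ⟨b, -, hb⟩ := (isCompact_closedBall (0 : ℂ) 1).ultrafilter_le_nhds (U.map f) (by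
    rw [le_principal_iff]
    exact Filter.univ_mem' (f := (U : Filter A)) fun a => by simpa using hf a)
  exact ⟨b, hb⟩

/-! ### Continuity in the parameters -/

namespace HasExpansions

variable (hexp : HasExpansions I M) (hM : D.IsUniqueRHFamily I M) (hI : IsOpen I)
  (y : ℝ) {t : ℝ} (ht : t ∈ I)
include hexp hM hI ht

/-- The values at `k = 0` depend continuously on the time. -/
theorem tendsto_atZero_time :
    Tendsto (fun t' => atZero (M y t')) (𝓝 t) (𝓝 (atZero (M y t))) := by
  refine continuousAt_iff_punctured_nhds.2 ?_
  rw [tendsto_iff_ultrafilter]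
  intro U hU
  set A := atZero (M y t) with hA
  set A' : ℝ → Mat := fun t' => atZero (M y t') with hA'
  -- No bound on `A' t'` near `t` is available. Dividing by `1 + m` makes everything bounded, so
  -- limits exist along any ultrafilter, and the rescaling argument can be run for the normalized
  -- family.
  set m : ℝ → ℝ := fun t' => ‖A' t' 0 0‖ + ‖A' t' 0 1‖ + ‖A' t' 1 0‖ + ‖A' t' 1 1‖ with hm
  have hm0 : ∀ t', 0 < 1 + m t' := fun t' => by positivity
  set r : ℝ → ℂ := fun t' => ((1 + m t' : ℝ) : ℂ)⁻¹ with hr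
  have hrn : ∀ t', ‖r t'‖ = (1 + m t')⁻¹ := fun t' => by
    simp only [hr, norm_inv, Complex.norm_real, Real.norm_eq_abs, abs_of_pos (hm0 t')]
  obtain ⟨ρ, hρ⟩ := exists_ultrafilter_tendsto U (f := r) fun t' => by
    rw [hrn]
    exact inv_le_one_of_one_le₀ (by have : 0 ≤ m t' := by positivity
                                    linarith)
  have hB : ∀ i j, ∃ b, Tendsto (fun t' => r t' * A' t' i j) U (𝓝 b) := by
    intro i j
    refine exists_ultrafilter_tendsto U fun t' => ?_
    rw [norm_mul, hrn, inv_mul_le_iff₀ (hm0 t'), mul_one]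
    have h00 := norm_nonneg (A' t' 0 0)
    have h01 := norm_nonneg (A' t' 0 1)
    have h10 := norm_nonneg (A' t' 1 0)
    have h11 := norm_nonneg (A' t' 1 1)
    fin_cases i <;> fin_cases j <;> simp only [hm, Fin.zero_eta, Fin.mk_one] <;> linarith
  choose B hB using hB
  have hBt : Tendsto (fun t' => r t' • A' t') U (𝓝 (Matrix.of B)) := tendsto_mat_iff.2 hB
  obtain ⟨E, hE⟩ := exists_entire_time hM y ht
  have hUt : Tendsto (fun t' : ℝ => (y, t')) U (𝓝 (y, t)) :=
    (tendsto_prodMk_nhds y t).mono_left (hU.trans nhdsWithin_le_nhds)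
  have hIU : ∀ᶠ t' in (U : Filter ℝ), t' ∈ I := hU (mem_nhdsWithin_of_mem_nhds (hI.mem_nhds ht))
  have hlim := tendsto_of_tendsto_offRealInfty (l := (U : Filter ℝ)) (δ := fun t' => t' - t)
    ((tendsto_sub_nhdsNE t).mono_left hU) (E := fun t' z => r t' • E t' z)
    (N' := fun t' z => r t' • M y t' z⁻¹) (N := fun _ z => M y t z⁻¹) (c := Complex.I / 4)
    (B' := Matrix.of B) (B := A)
    (by
      filter_upwards [hIU] with t' ht' i j
      exact ((hE t' ht').1 i j).const_mul (r t'))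
    (by
      filter_upwards [(tendsto_inv_offRealInfty.eventually
        D.eventually_nhds_zero_regular).prod_mk hIU] with p hp
      have := (hE p.2 hp.2).2.1 _ hp.1
      rw [inv_inv] at this
      rw [this, Matrix.smul_mul, Matrix.smul_mul])
    (by
      have h1 := (tendsto_uncurry_sub hexp.zero_zeroth (isOpen_univ.prod hI) (p := (y, t))
        ⟨trivial, ht⟩).comp (tendsto_inv_offRealInfty.prodMap hUt)
      have h2 := ((hρ.comp (tendsto_snd (f := offRealInfty))).smul h1).add
        (hBt.comp (tendsto_snd (f := offRealInfty)))
      rw [smul_zero, zero_add] at h2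
      refine h2.congr fun p => ?_
      simp only [Function.comp, Prod.map, hA', ← smul_add, sub_add_cancel])
    ((hexp.tendsto_atZero y ht).comp (tendsto_inv_offRealInfty.comp tendsto_fst)) 0
  have hdet := hexp.det_atZero hM y ht
  -- At ζ = 0, that is k = ∞, the unnormalized quotient equals 1, so its normalized limit is both ρ
  -- times the identity and `B` times adj A.
  have hBA : Matrix.of B = ρ • A := by
    have h1 : Tendsto (fun t' => r t' • E t' 0) U (𝓝 (ρ • (1 : Mat))) := by
      refine (hρ.smul_const (1 : Mat)).congr' ?_
      filter_upwards [hIU] with t' ht'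
      rw [(hE t' ht').2.2]
    have h2 := tendsto_nhds_unique h1 hlim
    have h3 := congrArg (· * A) h2
    simp only [Matrix.smul_mul, Matrix.one_mul, Matrix.mul_assoc] at h3
    rw [adjugate_mul_self hdet, Matrix.mul_one] at h3
    exact h3.symm
  -- Limit of m/(1 + m) = 1 - 1/(1 + m). If ρ vanished, so would `B = ρ A`, and this would read 0 =
  -- 1; hence no blow-up occurs.
  have hsum : ‖B 0 0‖ + ‖B 0 1‖ + ‖B 1 0‖ + ‖B 1 1‖ = 1 - ‖ρ‖ := by
    refine tendsto_nhds_unique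
      ((((hB 0 0).norm.add (hB 0 1).norm).add (hB 1 0).norm).add (hB 1 1).norm)
      ((hρ.norm.const_sub 1).congr fun t' => ?_)
    have := (hm0 t').ne'
    simp only [norm_mul, hrn]
    rw [← mul_add, ← mul_add, ← mul_add]
    change _ = (1 + m t')⁻¹ * m t'
    field_simp
    ring
  have hρ0 : ρ ≠ 0 := by
    intro h0
    have hB0 : ∀ i j, B i j = 0 := fun i j => by
      have := congrFun (congrFun hBA i) j
      simpa [h0] using this
    simp [hB0, h0] at hsum
  have h4 := (hρ.inv₀ hρ0).smul hBt
  rw [hBA, smul_smul, inv_mul_cancel₀ hρ0, one_smul] at h4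
  refine h4.congr fun t' => ?_
  have : r t' ≠ 0 := inv_ne_zero (by exact_mod_cast (hm0 t').ne')
  rw [smul_smul, inv_mul_cancel₀ this, one_smul]

theorem tendsto_uncurry_zero_time :
    Tendsto (fun q : ℂ × ℝ => M y q.2 q.1) (𝓝[offReal] 0 ×ˢ 𝓝 t) (𝓝 (atZero (M y t))) := by
  have h1 := (tendsto_uncurry_sub hexp.zero_zeroth (isOpen_univ.prod hI) (p := (y, t))
    ⟨trivial, ht⟩).comp ((tendsto_id (x := 𝓝[offReal] 0)).prodMap (tendsto_prodMk_nhds y t))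
  have h2 := h1.add ((hexp.tendsto_atZero_time hM hI y ht).comp
    (tendsto_snd (f := 𝓝[offReal] (0 : ℂ))))
  simpa [Function.comp_def] using h2

/-- The solution at a regular point depends continuously on the time. -/
theorem tendsto_regular_time {k : ℂ} (hk : k ∈ D.regular) :
    Tendsto (fun t' => M y t' k) (𝓝 t) (𝓝 (M y t k)) := by
  refine continuousAt_iff_punctured_nhds.2 ?_
  obtain ⟨E, hE⟩ := exists_entire_time hM y ht
  have hIU : ∀ᶠ t' in 𝓝[≠] t, t' ∈ I := mem_nhdsWithin_of_mem_nhds (hI.mem_nhds ht)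
  have hlim := tendsto_of_tendsto_offRealInfty (δ := fun t' => t' - t)
    (tendsto_sub_nhdsNE t) (E := E)
    (N' := fun t' z => M y t' z⁻¹) (N := fun _ z => M y t z⁻¹) (c := Complex.I / 4)
    (hIU.mono fun t' ht' => (hE t' ht').1)
    (by
      filter_upwards [(tendsto_inv_offRealInfty.eventually
        D.eventually_nhds_zero_regular).prod_mk hIU] with p hp
      have := (hE p.2 hp.2).2.1 _ hp.1
      rwa [inv_inv] at this)
    ((hexp.tendsto_uncurry_zero_time hM hI y ht).comp
      (tendsto_inv_offRealInfty.prodMap (tendsto_id.mono_left nhdsWithin_le_nhds)))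
    ((hexp.tendsto_atZero y ht).comp (tendsto_inv_offRealInfty.comp tendsto_fst)) k⁻¹
  rw [mul_adjugate_self (hexp.det_atZero hM y ht)] at hlim
  have hexp' : Tendsto (fun t' : ℝ => expSigma3 (-(Complex.I / 4 * ((t' - t : ℝ) * k⁻¹))))
      (𝓝[≠] t) (𝓝 1) := by
    have : Continuous fun t' : ℝ => expSigma3 (-(Complex.I / 4 * ((t' - t : ℝ) * k⁻¹))) :=
      continuous_expSigma3.comp (by fun_prop)
    have := (this.tendsto t).mono_left (nhdsWithin_le_nhds (s := {t}ᶜ))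
    simpa using this
  have h1 := (hlim.mul_const (M y t k)).mul hexp'
  rw [one_mul, mul_one] at h1
  refine h1.congr' ?_
  filter_upwards [hIU] with t' ht'
  rw [(hE t' ht').2.1 k hk]
  simp only [Matrix.mul_assoc]
  rw [← Matrix.mul_assoc (adjugate _), adjugate_mul_self (hexp.det_regular hM y ht hk),
    Matrix.one_mul, expSigma3_mul, add_neg_cancel, expSigma3_zero, Matrix.mul_one]

omit hI ht in
/-- The quotients of the solutions with different space parameters. -/
theorem exists_entire_space : ∃ E : ℝ × ℝ → ℂ → Mat, ∀ p : ℝ × ℝ, p.2 ∈ I → IsEntire (E p) ∧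
    (∀ z ∈ D.regular, E p z = M p.1 p.2 z * expSigma3 (-Complex.I * ((p.1 - y : ℝ) * z)) *
      adjugate (M y p.2 z)) ∧ E p 0 = atZero (M p.1 p.2) * adjugate (atZero (M y p.2)) := by
  have : ∀ p : ℝ × ℝ, p.2 ∈ I → _ := fun p hp =>
    (hM y p.2 hp).1.exists_entire_of_eq_time (hM p.1 p.2 hp).1
      (hexp.tendsto_atZero y hp) (hexp.tendsto_atZero p.1 hp)
  choose! E hE using this
  exact ⟨E, hE⟩

/-- Solutions at the same time are compared, with the space variable varying. The normalization at
infinity holds locally uniformly in both parameters, so the quotient tends to 1 jointly, and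
continuity in time supplies the rest. -/
theorem continuousAt_regular_and_atZero :
    (∀ k ∈ D.regular, ContinuousAt (fun p : ℝ × ℝ => M p.1 p.2 k) (y, t)) ∧
      ContinuousAt (fun p : ℝ × ℝ => atZero (M p.1 p.2)) (y, t) := by
  obtain ⟨E, hE⟩ := hexp.exists_entire_space hM y
  set s : Set (ℝ × ℝ) := {p | p.1 = y} with hs
  have hIe : ∀ᶠ p in 𝓝 (y, t), p.2 ∈ I := continuousAt_snd.eventually (hI.mem_nhds ht)
  have hIs : ∀ᶠ p in 𝓝[sᶜ] (y, t), p.2 ∈ I := mem_nhdsWithin_of_mem_nhds hIe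
  have hyt : Tendsto (fun p : ℝ × ℝ => (y, p.2)) (𝓝 (y, t)) (𝓝 (y, t)) :=
    (by fun_prop : Continuous fun p : ℝ × ℝ => (y, p.2)).tendsto' _ _ rfl
  have hδ : Tendsto (fun p : ℝ × ℝ => p.1 - y) (𝓝[sᶜ] (y, t)) (𝓝[≠] 0) := by
    refine tendsto_nhdsWithin_iff.2 ⟨?_, ?_⟩
    · exact ((by fun_prop : Continuous fun p : ℝ × ℝ => p.1 - y).tendsto' _ _
        (sub_self y)).mono_left nhdsWithin_le_nhds
    · exact eventually_nhdsWithin_of_forall fun p hp => sub_ne_zero.2 hp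
  have hinf := hexp.tendsto_uncurry_infty y ht hI
  have hlim := tendsto_of_tendsto_offRealInfty hδ (E := E)
    (N' := fun p z => M p.1 p.2 z) (N := fun p z => M y p.2 z) (c := -Complex.I)
    (hIs.mono fun p hp => (hE p hp).1)
    (by
      filter_upwards [D.eventually_offRealInfty_regular.prod_mk hIs] with q hq
      exact (hE q.2 hq.2).2.1 _ hq.1)
    (hinf.mono_left (prod_mono le_rfl nhdsWithin_le_nhds))
    (hinf.comp (tendsto_id.prodMap (hyt.mono_left nhdsWithin_le_nhds)))
  rw [adjugate_one, mul_one] at hlim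
  -- The rescaling needs a nonzero rate, so approach along the line `p.1 = y` is treated separately,
  -- by continuity in time alone.
  have split : ∀ {f : ℝ × ℝ → Mat} {B : Mat}, Tendsto f (𝓝[s] (y, t)) (𝓝 B) →
      Tendsto f (𝓝[sᶜ] (y, t)) (𝓝 B) → Tendsto f (𝓝 (y, t)) (𝓝 B) := by
    intro f B h1 h2
    rw [← nhdsWithin_univ, ← Set.union_compl_self s, nhdsWithin_union]
    exact h1.sup h2
  have hsnd : Tendsto (fun p : ℝ × ℝ => p.2) (𝓝 (y, t)) (𝓝 t) := continuousAt_snd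
  constructor
  · intro k hk
    have htime := (hexp.tendsto_regular_time hM hI y ht hk).comp hsnd
    refine split ?_ ?_
    · refine (htime.mono_left nhdsWithin_le_nhds).congr' ?_
      filter_upwards [self_mem_nhdsWithin] with p hp
      have hp' : p.1 = y := hp
      simp [hp']
    · have hexp' : Tendsto (fun p : ℝ × ℝ => expSigma3 (-(-Complex.I * ((p.1 - y : ℝ) * k))))
          (𝓝[sᶜ] (y, t)) (𝓝 1) := by
        have : Continuous fun p : ℝ × ℝ => expSigma3 (-(-Complex.I * ((p.1 - y : ℝ) * k))) :=
          continuous_expSigma3.comp (by fun_prop)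
        have := (this.tendsto (y, t)).mono_left (nhdsWithin_le_nhds (s := sᶜ))
        simpa using this
      have h1 := ((hlim k).mul (htime.mono_left nhdsWithin_le_nhds)).mul hexp'
      rw [one_mul, mul_one] at h1
      refine h1.congr' ?_
      filter_upwards [hIs] with p hp
      rw [(hE p hp).2.1 k hk]
      simp only [Matrix.mul_assoc, Function.comp]
      rw [← Matrix.mul_assoc (adjugate _), adjugate_mul_self (hexp.det_regular hM y hp hk),
        Matrix.one_mul, expSigma3_mul, add_neg_cancel, expSigma3_zero, Matrix.mul_one]
  · have htime := (hexp.tendsto_atZero_time hM hI y ht).comp hsnd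
    refine split ?_ ?_
    · refine (htime.mono_left nhdsWithin_le_nhds).congr' ?_
      filter_upwards [self_mem_nhdsWithin] with p hp
      have hp' : p.1 = y := hp
      simp [hp']
    · have h1 := (hlim 0).mul (htime.mono_left nhdsWithin_le_nhds)
      rw [one_mul] at h1
      refine h1.congr' ?_
      filter_upwards [hIs] with p hp
      simp only [Function.comp]
      rw [(hE p hp).2.2, Matrix.mul_assoc, adjugate_mul_self (hexp.det_atZero hM y hp),
        Matrix.mul_one]

omit ht in
theorem continuousOn_slopeAtZero :
    ContinuousOn (fun p : ℝ × ℝ => slopeAtZero (M p.1 p.2)) (Set.univ ×ˢ I) := by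
  refine hexp.zero_first.continuousOn (Eventually.frequently ?_)
  filter_upwards [D.eventually_nhds_zero_regular] with k hk p hp
  have h1 := (hexp.continuousAt_regular_and_atZero hM hI p.1 hp.2).1 k hk
  have h2 := (hexp.continuousAt_regular_and_atZero hM hI p.1 hp.2).2
  have h3 : ContinuousAt (fun p : ℝ × ℝ =>
      (Complex.I / k) • (adjugate (atZero (M p.1 p.2)) * M p.1 p.2 k - 1)) p :=
    ((((continuous_adjugate.tendsto _).comp h2.tendsto).mul h1.tendsto).sub_const 1).const_smul _
  refine h3.continuousWithinAt.congr (fun p hp => ?_) ?_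
  · rw [inv_eq_adjugate (hexp.det_atZero hM p.1 hp.2)]
  · rw [inv_eq_adjugate (hexp.det_atZero hM p.1 hp.2)]

omit ht in
theorem continuousOn_of_infty_first {M₁ : ℝ × ℝ → Mat}
    (h : TendstoLocallyUniformlyOn (fun (k : ℂ) (p : ℝ × ℝ) => k • (M p.1 p.2 k - 1))
      M₁ offRealInfty (Set.univ ×ˢ I)) : ContinuousOn M₁ (Set.univ ×ˢ I) := by
  refine h.continuousOn (Eventually.frequently ?_)
  filter_upwards [D.eventually_offRealInfty_regular] with k hk p hp
  have h1 := (hexp.continuousAt_regular_and_atZero hM hI p.1 hp.2).1 k hk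
  exact ((h1.sub continuousAt_const).const_smul k).continuousWithinAt

end HasExpansions

end Family

/-! ### The Lax pair and its limit at the origin -/

theorem hasDerivAt_of_tendsto_uncurry {ι : Type*} {l : Filter ι} [NeBot l] {f f' : ι → ℝ → ℂ}
    {g g' : ℝ → ℂ} {x : ℝ}
    (hf : ∀ᶠ q : ι × ℝ in l ×ˢ 𝓝 x, HasDerivAt (f q.1) (f' q.1 q.2) q.2)
    (hf' : Tendsto (fun q : ι × ℝ => f' q.1 q.2) (l ×ˢ 𝓝 x) (𝓝 (g' x)))
    (hg' : ContinuousAt g' x)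
    (hfg : ∀ᶠ y in 𝓝 x, Tendsto (fun n => f n y) l (𝓝 (g y))) : HasDerivAt g (g' x) x := by
  refine hasDerivAt_of_tendstoUniformlyOnFilter (f' := f') ?_ hf hfg
  rw [tendstoUniformlyOnFilter_iff_tendsto]
  have h := (hg'.tendsto.comp (tendsto_snd (f := l))).prodMk_nhds hf'
  exact h.mono_right (nhds_le_uniformity _)

theorem HasMatDerivAt.re {f : ℝ → Mat} {f' : Mat} {s : ℝ} (h : HasMatDerivAt f f' s)
    (i j : Fin 2) : HasDerivAt (fun r => (f r i j).re) (f' i j).re s :=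
  Complex.reCLM.hasFDerivAt.comp_hasDerivAt s (h i j)

theorem adjugate_adjugate_mat (A : Mat) : adjugate (adjugate A) = A := by
  ext i j
  fin_cases i <;> fin_cases j <;> simp [Matrix.adjugate_fin_two]

theorem trace_commutator (A B : Mat) : (A * B - B * A).trace = 0 := by
  rw [trace_sub, trace_mul_comm, sub_self]

theorem HasMatDerivAt.congr_deriv {f : ℝ → Mat} {f' g' : Mat} {s : ℝ} (h : HasMatDerivAt f f' s)
    (h' : f' = g') : HasMatDerivAt f g' s := h' ▸ h

namespace HasExpansions

variable {D : SpectralData} {I : Set ℝ} {M : ℝ → ℝ → ℂ → Mat}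
  (hexp : HasExpansions I M) (hM : D.IsUniqueRHFamily I M) (hI : IsOpen I)
include hexp hM hI

theorem continuousAt_atZero (y : ℝ) {t : ℝ} (ht : t ∈ I) :
    ContinuousAt (fun p : ℝ × ℝ => atZero (M p.1 p.2)) (y, t) :=
  (hexp.continuousAt_regular_and_atZero hM hI y ht).2

theorem continuousAt_slopeAtZero (y : ℝ) {t : ℝ} (ht : t ∈ I) :
    ContinuousAt (fun p : ℝ × ℝ => slopeAtZero (M p.1 p.2)) (y, t) :=
  (hexp.continuousOn_slopeAtZero hM hI).continuousAt
    ((isOpen_univ.prod hI).mem_nhds ⟨trivial, ht⟩)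

theorem tendsto_uncurry_zero (y : ℝ) {t : ℝ} (ht : t ∈ I) :
    Tendsto (fun q : ℂ × (ℝ × ℝ) => M q.2.1 q.2.2 q.1) (𝓝[offReal] 0 ×ˢ 𝓝 (y, t))
      (𝓝 (atZero (M y t))) :=
  tendsto_uncurry hexp.zero_zeroth (isOpen_univ.prod hI) (p := (y, t)) ⟨trivial, ht⟩
    (hexp.continuousAt_atZero hM hI y ht)

theorem tendsto_uncurry_slope (y : ℝ) {t : ℝ} (ht : t ∈ I) :
    Tendsto (fun q : ℂ × (ℝ × ℝ) =>
      (Complex.I / q.1) • ((atZero (M q.2.1 q.2.2))⁻¹ * M q.2.1 q.2.2 q.1 - 1))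
      (𝓝[offReal] 0 ×ˢ 𝓝 (y, t)) (𝓝 (slopeAtZero (M y t))) :=
  tendsto_uncurry hexp.zero_first (isOpen_univ.prod hI) (p := (y, t)) ⟨trivial, ht⟩
    (hexp.continuousAt_slopeAtZero hM hI y ht)

/-- The `x`-equation of the Lax pair. -/
theorem exists_hasMatDerivAt_space : ∃ B : ℝ × ℝ → Mat, ContinuousOn B (Set.univ ×ˢ I) ∧
    ∀ y : ℝ, ∀ t ∈ I, (B (y, t)).trace = 0 ∧
      HasMatDerivAt (fun y' => atZero (M y' t)) (B (y, t) * atZero (M y t)) y ∧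
      ∀ k ∈ D.regular, HasMatDerivAt (fun y' => M y' t k)
        ((k • sigma3 (-Complex.I) + B (y, t)) * M y t k + M y t k * sigma3 (Complex.I * k)) y := by
  obtain ⟨M₁, hM₁⟩ := hexp.infty_first
  have hcont := hexp.continuousOn_of_infty_first hM hI hM₁
  -- The potential of the x-equation is the constant term of the first order rescaling limit, for
  -- the rate `c = -I` of the spatial twist.
  refine ⟨fun p => M₁ p * sigma3 (-Complex.I) - sigma3 (-Complex.I) * M₁ p,
    (hcont.mul continuousOn_const).sub (continuousOn_const.mul hcont), fun y t ht =>
    ⟨trace_commutator _ _, ?_⟩⟩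
  obtain ⟨E, hE⟩ := hexp.exists_entire_space hM y
  have hmem : (y, t) ∈ Set.univ ×ˢ I := ⟨trivial, ht⟩
  have hjoint := tendsto_uncurry hM₁ (isOpen_univ.prod hI) hmem
    (hcont.continuousAt ((isOpen_univ.prod hI).mem_nhds hmem))
  have hy : Tendsto (fun y' : ℝ => (y', t)) (𝓝[≠] y) (𝓝 (y, t)) :=
    ((Continuous.prodMk_left t).tendsto y).mono_left nhdsWithin_le_nhds
  have hM₁t := hM₁.tendsto_at hmem
  have hlim := tendsto_inv_smul_sub_one (l := 𝓝[≠] y) (δ := fun y' => y' - y)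
    (tendsto_sub_nhdsNE y) (E := fun y' => E (y', t)) (N' := fun y' z => M y' t z)
    (N := fun _ z => M y t z) (c := -Complex.I) (L := M₁ (y, t))
    (Eventually.of_forall fun y' => (hE (y', t) ht).1)
    (by
      filter_upwards [D.eventually_offRealInfty_regular.prod_inl _] with q hq
      exact (hE (q.2, t) ht).2.1 _ hq)
    (hjoint.comp (tendsto_id.prodMap hy))
    (hM₁t.comp tendsto_fst)
    (trace_eq_zero_of_tendsto hM y ht hM₁t)
  constructor
  · have hE0 : E (y, t) 0 = 1 := by
      rw [(hE (y, t) ht).2.2, mul_adjugate_self (hexp.det_atZero hM y ht)]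
    have h1 := (HasMatDerivAt.of_tendsto (f := fun y' => E (y', t) 0) hE0 (hlim 0)).mul
      (HasMatDerivAt.const (atZero (M y t)) y)
    refine (h1.congr_deriv (by simp)).congr_of_eventuallyEq (Eventually.of_forall fun y' => ?_)
    rw [(hE (y', t) ht).2.2, Matrix.mul_assoc, adjugate_mul_self (hexp.det_atZero hM y ht),
      Matrix.mul_one]
  · intro k hk
    have hEk : E (y, t) k = 1 := by
      rw [(hE (y, t) ht).2.1 k hk]
      simp [mul_adjugate_self (hexp.det_regular hM y ht hk)]
    have h1 := ((HasMatDerivAt.of_tendsto (f := fun y' => E (y', t) k) hEk (hlim k)).mul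
      (HasMatDerivAt.const (M y t k) y)).mul (HasMatDerivAt.expSigma3 (Complex.I * k) y)
    refine (h1.congr_deriv (by simp [hEk])).congr_of_eventuallyEq
      (Eventually.of_forall fun y' => ?_)
    rw [(hE (y', t) ht).2.1 k hk]
    simp only [Matrix.mul_assoc]
    rw [← Matrix.mul_assoc (adjugate _), adjugate_mul_self (hexp.det_regular hM y ht hk),
      Matrix.one_mul, expSigma3_mul]
    have : -Complex.I * ((y' - y : ℝ) * k) + Complex.I * k * ((y' - y : ℝ) : ℂ) = 0 := by ring
    rw [this, expSigma3_zero, Matrix.mul_one]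

/-- In the derivative of A⁻¹M the potential `B` cancels, because it governs both A and M. What
remains carries a factor k, which absorbs the 1/k of the slope, so derivative and limit k → 0 can be
exchanged. -/
theorem hasMatDerivAt_slopeAtZero_space (y : ℝ) {t : ℝ} (ht : t ∈ I) :
    HasMatDerivAt (fun y' => slopeAtZero (M y' t))
      (adjugate (atZero (M y t)) * sigma3 1 * atZero (M y t) - sigma3 1) y := by
  obtain ⟨B, -, hB⟩ := hexp.exists_hasMatDerivAt_space hM hI
  have hy : Tendsto (fun y' : ℝ => (y', t)) (𝓝 y) (𝓝 (y, t)) :=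
    (Continuous.prodMk_left t).tendsto y
  have hAc : ContinuousAt (fun y' => atZero (M y' t)) y := by
    have h := (hexp.continuousAt_atZero hM hI y ht).tendsto.comp hy
    exact h
  have hadjc : ContinuousAt (fun y' => adjugate (atZero (M y' t))) y := by
    have h := (continuous_adjugate.tendsto _).comp hAc.tendsto
    exact h
  have hderiv : ∀ k ∈ D.regular, ∀ y', HasMatDerivAt
      (fun y' => adjugate (atZero (M y' t)) * M y' t k)
      (k • (adjugate (atZero (M y' t)) * sigma3 (-Complex.I) * M y' t k +
        adjugate (atZero (M y' t)) * M y' t k * sigma3 Complex.I)) y' := by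
    intro k hk y'
    obtain ⟨htr, hA, hMk⟩ := hB y' t ht
    refine (hA.adjugate.mul (hMk k hk)).congr_deriv ?_
    have hs : sigma3 (Complex.I * k) = k • sigma3 Complex.I := by
      ext i j
      fin_cases i <;> fin_cases j <;> simp [sigma3, mul_comm]
    rw [adjugate_mul_distrib, adjugate_eq_neg_of_trace htr, hs]
    simp only [Matrix.mul_add, Matrix.add_mul, Matrix.mul_smul, Matrix.smul_mul, Matrix.mul_neg,
      Matrix.neg_mul, Matrix.mul_assoc, smul_add]
    abel
  have hval : ∀ k : ℂ, k ≠ 0 → ∀ A V : Mat,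
      (Complex.I / k) • (k • (A * sigma3 (-Complex.I) * V + A * V * sigma3 Complex.I)) =
        A * sigma3 1 * V - A * V * sigma3 1 := by
    intro k hk A V
    have e1 : Complex.I • sigma3 (-Complex.I) = sigma3 1 := by
      ext i j
      fin_cases i <;> fin_cases j <;> simp [sigma3]
    have e2 : Complex.I • sigma3 Complex.I = -sigma3 1 := by
      ext i j
      fin_cases i <;> fin_cases j <;> simp [sigma3]
    rw [smul_smul, div_mul_cancel₀ _ hk, smul_add, ← Matrix.smul_mul, ← Matrix.mul_smul,
      ← Matrix.mul_smul (A * V), e1, e2, Matrix.mul_neg, sub_eq_add_neg]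
  have hjoint : Tendsto (fun q : ℂ × ℝ => M q.2 t q.1) (𝓝[offReal] 0 ×ˢ 𝓝 y)
      (𝓝 (atZero (M y t))) := by
    have h := (hexp.tendsto_uncurry_zero hM hI y ht).comp (tendsto_id.prodMap hy)
    exact h
  have hadj : Tendsto (fun q : ℂ × ℝ => adjugate (atZero (M q.2 t))) (𝓝[offReal] 0 ×ˢ 𝓝 y)
      (𝓝 (adjugate (atZero (M y t)))) := by
    have h := hadjc.tendsto.comp (tendsto_snd (f := 𝓝[offReal] (0 : ℂ)))
    exact h
  have hlim : Tendsto (fun q : ℂ × ℝ => adjugate (atZero (M q.2 t)) * sigma3 1 * M q.2 t q.1 -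
      adjugate (atZero (M q.2 t)) * M q.2 t q.1 * sigma3 1) (𝓝[offReal] 0 ×ˢ 𝓝 y)
      (𝓝 (adjugate (atZero (M y t)) * sigma3 1 * atZero (M y t) - sigma3 1)) := by
    have := ((hadj.mul_const (sigma3 1)).mul hjoint).sub
      ((hadj.mul hjoint).mul_const (sigma3 1))
    rwa [adjugate_mul_self (hexp.det_atZero hM y ht), Matrix.one_mul] at this
  have hg' : ContinuousAt (fun y' => adjugate (atZero (M y' t)) * sigma3 1 * atZero (M y' t) -
      sigma3 1) y :=
    ((hadjc.tendsto.mul_const (sigma3 1)).mul hAc.tendsto).sub_const (sigma3 1)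
  intro i j
  obtain ⟨f, hf⟩ : ∃ f : ℂ → ℝ → ℂ, ∀ k, f k = fun y' =>
      ((Complex.I / k) • (adjugate (atZero (M y' t)) * M y' t k - 1)) i j := ⟨_, fun _ => rfl⟩
  obtain ⟨f', hf'⟩ : ∃ f' : ℂ → ℝ → ℂ, ∀ k y', f' k y' =
      (adjugate (atZero (M y' t)) * sigma3 1 * M y' t k -
        adjugate (atZero (M y' t)) * M y' t k * sigma3 1) i j := ⟨_, fun _ _ => rfl⟩
  obtain ⟨g, hg⟩ : ∃ g : ℝ → ℂ, g = fun y' => slopeAtZero (M y' t) i j := ⟨_, rfl⟩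
  obtain ⟨g', hg''⟩ : ∃ g' : ℝ → ℂ, ∀ y', g' y' =
      (adjugate (atZero (M y' t)) * sigma3 1 * atZero (M y' t) - sigma3 1) i j :=
    ⟨_, fun _ => rfl⟩
  rw [← hg, ← hg'' y]
  refine hasDerivAt_of_tendsto_uncurry (l := 𝓝[offReal] (0 : ℂ)) (f := f) (f' := f') ?_ ?_ ?_ ?_
  · filter_upwards [D.eventually_nhds_zero_regular.prod_inl _] with q hq
    rw [hf, hf', ← hval q.1 (SpectralData.ne_zero_of_mem_offReal hq.1)]
    simp only [Matrix.smul_apply, Matrix.sub_apply, smul_eq_mul]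
    exact ((hderiv q.1 hq q.2 i j).sub_const ((1 : Mat) i j)).const_mul (Complex.I / q.1)
  · simp only [hf', hg'']
    exact tendsto_mat_iff.1 hlim i j
  · rw [funext hg'']
    exact tendsto_mat_iff.1 hg'.tendsto i j
  · refine Eventually.of_forall fun y' => ?_
    have := hexp.tendsto_slopeAtZero y' ht
    rw [inv_eq_adjugate (hexp.det_atZero hM y' ht)] at this
    simp only [hf, hg]
    exact tendsto_mat_iff.1 this i j

/-- The `t`-equation of the Lax pair, in the gauge that normalizes the solution at `k = 0`. -/
theorem hasMatDerivAt_time (y : ℝ) {t : ℝ} (ht : t ∈ I) :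
    HasMatDerivAt (fun t' => atZero (M y t'))
      (((f2 M y t / 2 : ℝ) : ℂ) • (atZero (M y t) * !![0, 1; -1, 0])) t ∧
    ∀ k ∈ D.regular, HasMatDerivAt (fun t' => adjugate (atZero (M y t')) * M y t' k)
      ((k⁻¹ • sigma3 (Complex.I / 4) - ((f2 M y t / 2 : ℝ) : ℂ) • !![0, 1; -1, 0]) *
        (adjugate (atZero (M y t)) * M y t k) +
        adjugate (atZero (M y t)) * M y t k * sigma3 (-(Complex.I / 4 * k⁻¹))) t := by
  set A := atZero (M y t) with hA
  set G := slopeAtZero (M y t) with hG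
  have hdet : A.det = 1 := hexp.det_atZero hM y ht
  set C : Mat := -(((f2 M y t / 2 : ℝ) : ℂ) • !![0, 1; -1, 0]) with hC
  have hGe := hexp.slopeAtZero_eq hM y ht
  -- In ζ = 1/k the expansion of A⁻¹M at infinity has first coefficient -iG. Its commutator with
  -- iσ₃/4 loses the diagonal part `f1` and retains `f2`.
  have hCG : (-Complex.I • G) * sigma3 (Complex.I / 4) - sigma3 (Complex.I / 4) * (-Complex.I • G)
      = C := by
    have hI2 := Complex.I_mul_I
    rw [hG, hGe, hC]
    ext i j
    fin_cases i <;> fin_cases j <;>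
      simp [sigma3]
    · ring
    · linear_combination ((f2 M y t : ℂ) / 2) * hI2
    · linear_combination -((f2 M y t : ℂ) / 2) * hI2
    · ring
  have hCtr : C.trace = 0 := by
    rw [← hCG]
    exact trace_commutator _ _
  have hLtr : (-Complex.I • G).trace = 0 := by
    rw [trace_smul, hG, hGe, trace_fin_two_of]
    simp
  obtain ⟨E, hE⟩ := exists_entire_time hM y ht
  have hIt : ∀ᶠ t' in 𝓝 t, t' ∈ I := hI.mem_nhds ht
  have hIU : ∀ᶠ t' in 𝓝[≠] t, t' ∈ I := mem_nhdsWithin_of_mem_nhds hIt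
  -- Passing to A⁻¹M makes both factors of the quotient tend to 1 as ζ → ∞, as the first order
  -- rescaling requires. The price is F(0) = A'⁻¹A in place of 1, which is what yields the evolution
  -- of A.
  set F : ℝ → ℂ → Mat := fun t' ζ => adjugate (atZero (M y t')) * E t' ζ * A with hF
  have hscale : ∀ (z : ℂ) (V : Mat), -Complex.I • ((Complex.I / z⁻¹) • V) = z • V := by
    intro z V
    rw [smul_smul, div_inv_eq_mul, ← mul_assoc, neg_mul, Complex.I_mul_I, neg_neg, one_mul]
  have hlim := tendsto_inv_smul_sub_one (l := 𝓝[≠] t) (δ := fun t' => t' - t)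
    (tendsto_sub_nhdsNE t) (E := F)
    (N' := fun t' z => adjugate (atZero (M y t')) * M y t' z⁻¹)
    (N := fun _ z => adjugate A * M y t z⁻¹) (c := Complex.I / 4) (L := -Complex.I • G)
    (by
      filter_upwards [hIU] with t' ht' i j
      have h := (hE t' ht').1
      have h00 := h 0 0
      have h01 := h 0 1
      have h10 := h 1 0
      have h11 := h 1 1
      simp only [hF, Matrix.mul_apply, Fin.sum_univ_two]
      fun_prop)
    (by
      filter_upwards [(tendsto_inv_offRealInfty.eventually
        D.eventually_nhds_zero_regular).prod_mk hIU] with p hp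
      have := (hE p.2 hp.2).2.1 _ hp.1
      rw [inv_inv] at this
      simp only [hF, this, adjugate_mul_distrib, adjugate_adjugate_mat, Matrix.mul_assoc])
    (by
      have h1 := ((hexp.tendsto_uncurry_slope hM hI y ht).comp
        (tendsto_inv_offRealInfty.prodMap ((tendsto_prodMk_nhds y t).mono_left
          (nhdsWithin_le_nhds (s := {t}ᶜ))))).const_smul (-Complex.I)
      refine h1.congr' ?_
      filter_upwards [hIU.prod_inr _] with p hp
      simp only [Function.comp, Prod.map, hscale]
      rw [inv_eq_adjugate (hexp.det_atZero hM y hp)])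
    (by
      have h1 := ((hexp.tendsto_slopeAtZero y ht).comp
        (tendsto_inv_offRealInfty.comp (tendsto_fst (g := 𝓝[≠] t)))).const_smul (-Complex.I)
      refine h1.congr fun p => ?_
      simp only [Function.comp, hscale]
      rw [inv_eq_adjugate hdet])
    hLtr
  rw [hCG] at hlim
  have hF0 : ∀ t' ∈ I, F t' 0 = adjugate (atZero (M y t')) * A := by
    intro t' ht'
    simp only [hF, (hE t' ht').2.2, Matrix.mul_one]
  constructor
  · have h1 := (HasMatDerivAt.of_tendsto (f := fun t' => F t' 0)
      (by rw [hF0 t ht, adjugate_mul_self hdet]) (hlim 0)).mul (HasMatDerivAt.const (adjugate A) t)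
    refine (h1.adjugate.congr_deriv ?_).congr_of_eventuallyEq (hIt.mono fun t' ht' => ?_)
    · simp only [zero_smul, zero_add, mul_zero, add_zero]
      rw [adjugate_mul_distrib, adjugate_adjugate_mat, adjugate_eq_neg_of_trace hCtr, hC, neg_neg,
        Matrix.mul_smul]
    · rw [hF0 t' ht', Matrix.mul_assoc, mul_adjugate_self hdet, Matrix.mul_one,
        adjugate_adjugate_mat]
  · intro k hk
    have hFk : ∀ t' ∈ I, F t' k⁻¹ = adjugate (atZero (M y t')) * M y t' k *
        expSigma3 (Complex.I / 4 * ((t' - t : ℝ) * k⁻¹)) * adjugate (M y t k) * A := by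
      intro t' ht'
      simp only [hF, (hE t' ht').2.1 k hk, Matrix.mul_assoc]
    have hF1 : F t k⁻¹ = 1 := by
      rw [hFk t ht]
      simp only [sub_self, Complex.ofReal_zero, zero_mul, mul_zero, expSigma3_zero, Matrix.mul_one]
      rw [Matrix.mul_assoc (adjugate _), mul_adjugate_self (hexp.det_regular hM y ht hk),
        Matrix.mul_one, adjugate_mul_self hdet]
    have h1 := ((HasMatDerivAt.of_tendsto (f := fun t' => F t' k⁻¹) hF1 (hlim k⁻¹)).mul
      (HasMatDerivAt.const (adjugate A * M y t k) t)).mul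
        (HasMatDerivAt.expSigma3 (-(Complex.I / 4 * k⁻¹)) t)
    refine (h1.congr_deriv ?_).congr_of_eventuallyEq (hIt.mono fun t' ht' => ?_)
    · simp [hF1, hC, sub_eq_add_neg]
    · rw [hFk t' ht']
      simp only [Matrix.mul_assoc]
      rw [← Matrix.mul_assoc A, mul_adjugate_self hdet, Matrix.one_mul,
        ← Matrix.mul_assoc (adjugate (M y t k)),
        adjugate_mul_self (hexp.det_regular hM y ht hk), Matrix.one_mul, expSigma3_mul]
      have : Complex.I / 4 * ((t' - t : ℝ) * k⁻¹) +
          -(Complex.I / 4 * k⁻¹) * ((t' - t : ℝ) : ℂ) = 0 := by ring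
      rw [this, expSigma3_zero, Matrix.mul_one]

/-- In the (0, 0) entry of the t-equation the singular terms with 1/k commute and cancel. There
remains -f₂/2 times the (1, 0) entry, whose slope at k = 0 is f₂. -/
theorem hasDerivAt_f1_time (y : ℝ) {t : ℝ} (ht : t ∈ I) :
    HasDerivAt (fun t' => f1 M y t') (-(f2 M y t) ^ 2 / 2) t := by
  have hIt : ∀ᶠ t' in 𝓝 t, t' ∈ I := hI.mem_nhds ht
  have hGc : ContinuousAt (fun t' => slopeAtZero (M y t')) t := by
    have h := (hexp.continuousAt_slopeAtZero hM hI y ht).tendsto.comp (tendsto_prodMk_nhds y t)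
    exact h
  have hf2c : ContinuousAt (fun t' => (f2 M y t' : ℂ)) t := by
    have h := ((Complex.continuous_ofReal.comp Complex.continuous_re).tendsto _).comp
      (tendsto_mat_iff.1 hGc.tendsto 0 1)
    exact h
  have hjoint : Tendsto (fun q : ℂ × ℝ =>
      ((Complex.I / q.1) • ((atZero (M y q.2))⁻¹ * M y q.2 q.1 - 1)) 1 0)
      (𝓝[offReal] 0 ×ˢ 𝓝 t) (𝓝 (slopeAtZero (M y t) 1 0)) := by
    have h := (hexp.tendsto_uncurry_slope hM hI y ht).comp
      (tendsto_id.prodMap (tendsto_prodMk_nhds y t))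
    exact tendsto_mat_iff.1 h 1 0
  have h10 : slopeAtZero (M y t) 1 0 = f2 M y t := by
    rw [hexp.slopeAtZero_eq hM y ht]
    rfl
  rw [h10] at hjoint
  have key : HasDerivAt (fun t' => slopeAtZero (M y t') 0 0)
      (-(f2 M y t : ℂ) / 2 * f2 M y t) t := by
    obtain ⟨f, hf⟩ : ∃ f : ℂ → ℝ → ℂ, ∀ k, f k = fun t' =>
        ((Complex.I / k) • (adjugate (atZero (M y t')) * M y t' k - 1)) 0 0 := ⟨_, fun _ => rfl⟩
    obtain ⟨f', hf'⟩ : ∃ f' : ℂ → ℝ → ℂ, ∀ k t', f' k t' = -(f2 M y t' : ℂ) / 2 *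
        ((Complex.I / k) • ((atZero (M y t'))⁻¹ * M y t' k - 1)) 1 0 := ⟨_, fun _ _ => rfl⟩
    obtain ⟨g, hg⟩ : ∃ g : ℝ → ℂ, g = fun t' => slopeAtZero (M y t') 0 0 := ⟨_, rfl⟩
    obtain ⟨g', hg'⟩ : ∃ g' : ℝ → ℂ, ∀ t', g' t' = -(f2 M y t' : ℂ) / 2 * f2 M y t' :=
      ⟨_, fun _ => rfl⟩
    rw [← hg, ← hg' t]
    refine hasDerivAt_of_tendsto_uncurry (l := 𝓝[offReal] (0 : ℂ)) (f := f) (f' := f') ?_ ?_ ?_ ?_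
    · filter_upwards [D.eventually_nhds_zero_regular.prod_mk hIt] with q hq
      have h := (hexp.hasMatDerivAt_time hM hI y hq.2).2 q.1 hq.1 0 0
      rw [hf, hf', inv_eq_adjugate (hexp.det_atZero hM y hq.2)]
      simp only [Matrix.smul_apply, Matrix.sub_apply, smul_eq_mul]
      refine ((h.sub_const ((1 : Mat) 0 0)).const_mul (Complex.I / q.1)).congr_deriv ?_
      generalize adjugate (atZero (M y q.2)) * M y q.2 q.1 = N
      simp [Matrix.mul_apply, Fin.sum_univ_two, sigma3, Matrix.vecMul, dotProduct]
      ring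
    · simp only [hf', hg']
      exact ((hf2c.tendsto.comp tendsto_snd).neg.div_const 2).mul hjoint
    · rw [funext hg']
      exact (hf2c.neg.div_const 2).mul hf2c
    · filter_upwards [hIt] with t' ht'
      have := hexp.tendsto_slopeAtZero y ht'
      rw [inv_eq_adjugate (hexp.det_atZero hM y ht')] at this
      simp only [hf, hg]
      exact tendsto_mat_iff.1 this 0 0
  have h2 := Complex.reCLM.hasFDerivAt.comp_hasDerivAt t key
  refine h2.congr_deriv ?_
  have : -(f2 M y t : ℂ) / 2 * f2 M y t = ((-(f2 M y t) ^ 2 / 2 : ℝ) : ℂ) := by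
    push_cast
    ring
  rw [this, Complex.reCLM_apply, Complex.ofReal_re]

/-! ### Differential equations for the profile functions -/

omit hI in
theorem alpha_sq_add_beta_sq (y : ℝ) {t : ℝ} (ht : t ∈ I) :
    alpha M y t ^ 2 + beta M y t ^ 2 = 1 := by
  have h := hexp.det_atZero hM y ht
  rw [hexp.atZero_eq hM y ht, det_fin_two_of] at h
  have h' : ((alpha M y t ^ 2 + beta M y t ^ 2 : ℝ) : ℂ) = ((1 : ℝ) : ℂ) := by
    push_cast
    linear_combination h
  exact_mod_cast h'

theorem hasDerivAt_alpha_beta_time (y : ℝ) {t : ℝ} (ht : t ∈ I) :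
    HasDerivAt (fun t' => alpha M y t') (-(beta M y t * f2 M y t / 2)) t ∧
      HasDerivAt (fun t' => beta M y t') (alpha M y t * f2 M y t / 2) t := by
  have h := (hexp.hasMatDerivAt_time hM hI y ht).1
  rw [hexp.atZero_eq hM y ht] at h
  constructor
  · refine (h.re 0 0).congr_deriv ?_
    simp
    ring
  · refine (h.re 0 1).congr_deriv ?_
    simp
    ring

theorem hasDerivAt_f1_f2_space (y : ℝ) {t : ℝ} (ht : t ∈ I) :
    HasDerivAt (fun y' => f1 M y' t) (alpha M y t ^ 2 - beta M y t ^ 2 - 1) y ∧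
      HasDerivAt (fun y' => f2 M y' t) (2 * alpha M y t * beta M y t) y := by
  have h := hexp.hasMatDerivAt_slopeAtZero_space hM hI y ht
  rw [hexp.atZero_eq hM y ht] at h
  constructor
  · refine (h.re 0 0).congr_deriv ?_
    simp [sigma3, Matrix.adjugate_fin_two]
    ring
  · refine (h.re 0 1).congr_deriv ?_
    simp [sigma3, Matrix.adjugate_fin_two]
    ring

/-- The actual values of these derivatives are irrelevant, since they drop out of the conservation
law; their continuity is needed for differentiability of q̂ in both variables jointly. -/
theorem exists_hasDerivAt_alpha_beta_space : ∃ a b : ℝ × ℝ → ℝ,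
    ContinuousOn a (Set.univ ×ˢ I) ∧ ContinuousOn b (Set.univ ×ˢ I) ∧
    ∀ y : ℝ, ∀ t ∈ I, HasDerivAt (fun y' => alpha M y' t) (a (y, t)) y ∧
      HasDerivAt (fun y' => beta M y' t) (b (y, t)) y := by
  obtain ⟨B, hBc, hB⟩ := hexp.exists_hasMatDerivAt_space hM hI
  have hA : ContinuousOn (fun p : ℝ × ℝ => atZero (M p.1 p.2)) (Set.univ ×ˢ I) :=
    fun p hp => (hexp.continuousAt_atZero hM hI p.1 hp.2).continuousWithinAt
  have hBA := hBc.mul hA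
  have hre : ∀ i j, ContinuousOn (fun p : ℝ × ℝ => ((B p * atZero (M p.1 p.2)) i j).re)
      (Set.univ ×ˢ I) := fun i j p hp =>
    (Complex.continuous_re.tendsto _).comp (tendsto_mat_iff.1 (hBA p hp) i j)
  exact ⟨_, _, hre 0 0, hre 0 1, fun y t ht =>
    ⟨(hB y t ht).2.1.re 0 0, (hB y t ht).2.1.re 0 1⟩⟩

theorem continuousAt_profiles (y : ℝ) {t : ℝ} (ht : t ∈ I) :
    ContinuousAt (fun p : ℝ × ℝ => alpha M p.1 p.2) (y, t) ∧
    ContinuousAt (fun p : ℝ × ℝ => beta M p.1 p.2) (y, t) ∧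
    ContinuousAt (fun p : ℝ × ℝ => f2 M p.1 p.2) (y, t) := by
  have hA := (hexp.continuousAt_atZero hM hI y ht).tendsto
  have hG := (hexp.continuousAt_slopeAtZero hM hI y ht).tendsto
  exact ⟨(Complex.continuous_re.tendsto _).comp (tendsto_mat_iff.1 hA 0 0),
    (Complex.continuous_re.tendsto _).comp (tendsto_mat_iff.1 hA 0 1),
    (Complex.continuous_re.tendsto _).comp (tendsto_mat_iff.1 hG 0 1)⟩

end HasExpansions

/-! ### From the profile equations to the short pulse equation -/

/-- A function of two real variables with continuous partial derivatives is strictly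
differentiable. -/
theorem hasStrictFDerivAt_of_partials {F F₁ F₂ : ℝ → ℝ → ℝ} {p : ℝ × ℝ}
    (h₁ : ∀ᶠ v in 𝓝 p, HasDerivAt (fun y => F y v.2) (F₁ v.1 v.2) v.1)
    (h₂ : ∀ᶠ v in 𝓝 p, HasDerivAt (fun t => F v.1 t) (F₂ v.1 v.2) v.2)
    (c₁ : ContinuousAt (fun v : ℝ × ℝ => F₁ v.1 v.2) p)
    (c₂ : ContinuousAt (fun v : ℝ × ℝ => F₂ v.1 v.2) p) :
    HasStrictFDerivAt (fun v : ℝ × ℝ => F v.1 v.2)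
      (F₁ p.1 p.2 • ContinuousLinearMap.fst ℝ ℝ ℝ + F₂ p.1 p.2 • ContinuousLinearMap.snd ℝ ℝ ℝ)
      p := by
  have key := hasStrictFDerivAt_uncurry_coprod (𝕜 := ℝ) (u := p) (f := F)
    (f₁ := fun a b => F₁ a b • ContinuousLinearMap.id ℝ ℝ)
    (f₂ := fun a b => F₂ a b • ContinuousLinearMap.id ℝ ℝ)
    (h₁.mono fun v hv => hv.hasFDerivAt.congr_fderiv (by ext; simp [Function.HasUncurry.uncurry]))
    (h₂.mono fun v hv => hv.hasFDerivAt.congr_fderiv (by ext; simp [Function.HasUncurry.uncurry]))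
    (c₁.smul continuousAt_const) (c₂.smul continuousAt_const)
  refine (key.congr_fderiv ?_ : _)
  ext <;> simp [Function.HasUncurry.uncurry]

/-- The linear isomorphism `(h, s) ↦ (c h + d s, s)`. -/
noncomputable def shearEquiv (c d : ℝ) (hc : c ≠ 0) : (ℝ × ℝ) ≃L[ℝ] (ℝ × ℝ) :=
  ContinuousLinearEquiv.equivOfInverse
    ((c • ContinuousLinearMap.fst ℝ ℝ ℝ + d • ContinuousLinearMap.snd ℝ ℝ ℝ).prod
      (ContinuousLinearMap.snd ℝ ℝ ℝ))
    ((c⁻¹ • ContinuousLinearMap.fst ℝ ℝ ℝ + (-(c⁻¹ * d)) • ContinuousLinearMap.snd ℝ ℝ ℝ).prod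
      (ContinuousLinearMap.snd ℝ ℝ ℝ))
    (fun p => by
      ext
      · simp [mul_add, hc]
        ring
      · simp)
    (fun p => by
      ext
      · simp [mul_add, hc]
        field_simp
        ring
      · simp)

theorem coe_shearEquiv (c d : ℝ) (hc : c ≠ 0) :
    (shearEquiv c d hc : (ℝ × ℝ) →L[ℝ] (ℝ × ℝ)) =
      (c • ContinuousLinearMap.fst ℝ ℝ ℝ + d • ContinuousLinearMap.snd ℝ ℝ ℝ).prod
        (ContinuousLinearMap.snd ℝ ℝ ℝ) := rfl

theorem coe_shearEquiv_symm (c d : ℝ) (hc : c ≠ 0) :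
    ((shearEquiv c d hc).symm : (ℝ × ℝ) →L[ℝ] (ℝ × ℝ)) =
      (c⁻¹ • ContinuousLinearMap.fst ℝ ℝ ℝ + (-(c⁻¹ * d)) • ContinuousLinearMap.snd ℝ ℝ ℝ).prod
        (ContinuousLinearMap.snd ℝ ℝ ℝ) := rfl

/-- The differential equations for the four profile functions of the Riemann-Hilbert problem imply
the short pulse equation in conservation law form, in the coordinates `(y + φ, t)`. -/
theorem shortPulse_of_profiles {α β φ f a b : ℝ → ℝ → ℝ} {I : Set ℝ} (hI : IsOpen I)
    (hcα : ∀ y, ∀ t ∈ I, ContinuousAt (fun p : ℝ × ℝ => α p.1 p.2) (y, t))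
    (hcβ : ∀ y, ∀ t ∈ I, ContinuousAt (fun p : ℝ × ℝ => β p.1 p.2) (y, t))
    (hcf : ∀ y, ∀ t ∈ I, ContinuousAt (fun p : ℝ × ℝ => f p.1 p.2) (y, t))
    (hca : ∀ y, ∀ t ∈ I, ContinuousAt (fun p : ℝ × ℝ => a p.1 p.2) (y, t))
    (hcb : ∀ y, ∀ t ∈ I, ContinuousAt (fun p : ℝ × ℝ => b p.1 p.2) (y, t))
    (hαβ : ∀ y, ∀ t ∈ I, α y t ^ 2 + β y t ^ 2 = 1)
    (hαy : ∀ y, ∀ t ∈ I, HasDerivAt (fun y => α y t) (a y t) y)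
    (hβy : ∀ y, ∀ t ∈ I, HasDerivAt (fun y => β y t) (b y t) y)
    (hαt : ∀ y, ∀ t ∈ I, HasDerivAt (fun t => α y t) (-(β y t * f y t / 2)) t)
    (hβt : ∀ y, ∀ t ∈ I, HasDerivAt (fun t => β y t) (α y t * f y t / 2) t)
    (hφy : ∀ y, ∀ t ∈ I, HasDerivAt (fun y => φ y t) (α y t ^ 2 - β y t ^ 2 - 1) y)
    (hφt : ∀ y, ∀ t ∈ I, HasDerivAt (fun t => φ y t) (-(f y t) ^ 2 / 2) t)
    (hfy : ∀ y, ∀ t ∈ I, HasDerivAt (fun y => f y t) (2 * α y t * β y t) y)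
    {Ω : Set (ℝ × ℝ)} (hΩ : IsOpen Ω) (hΩI : ∀ p ∈ Ω, p.2 ∈ I)
    (hpos : ∀ p ∈ Ω, 0 < α p.1 p.2 ^ 2 - β p.1 p.2 ^ 2) {xhat : ℝ → ℝ → ℝ}
    (hinv : ∀ p ∈ Ω, xhat (p.1 + φ p.1 p.2) p.2 = p.1) {u q : ℝ → ℝ → ℝ}
    (hu : ∀ x t, u x t = f (xhat x t) t)
    (hq : ∀ x t, q x t = 1 / (α (xhat x t) t ^ 2 - β (xhat x t) t ^ 2)) :
    IsOpen ((fun p : ℝ × ℝ => (p.1 + φ p.1 p.2, p.2)) '' Ω) ∧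
    ∀ x t : ℝ, (x, t) ∈ (fun p : ℝ × ℝ => (p.1 + φ p.1 p.2, p.2)) '' Ω →
      DifferentiableAt ℝ (fun x' => u x' t) x ∧
      DifferentiableAt ℝ (fun x' => q x' t) x ∧
      DifferentiableAt ℝ (fun t' => q x t') t ∧
      q x t = Real.sqrt (1 + deriv (fun x' => u x' t) x ^ 2) ∧
      deriv (fun t' => q x t') t = 1 / 2 * deriv (fun x' => u x' t ^ 2 * q x' t) x := by
  have hx : ∀ p ∈ Ω, HasStrictFDerivAt (fun p : ℝ × ℝ => (p.1 + φ p.1 p.2, p.2))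
      ((((α p.1 p.2 ^ 2 - β p.1 p.2 ^ 2) • ContinuousLinearMap.fst ℝ ℝ ℝ +
        (-(f p.1 p.2) ^ 2 / 2) • ContinuousLinearMap.snd ℝ ℝ ℝ).prod
        (ContinuousLinearMap.snd ℝ ℝ ℝ))) p := by
    intro p hp
    have hIe : ∀ᶠ v in 𝓝 p, v.2 ∈ I := continuousAt_snd.eventually (hI.mem_nhds (hΩI p hp))
    have h := hasStrictFDerivAt_of_partials (p := p) (F := fun y t => y + φ y t)
      (F₁ := fun y t => α y t ^ 2 - β y t ^ 2) (F₂ := fun y t => -(f y t) ^ 2 / 2)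
      (hIe.mono fun v hv => ((hasDerivAt_id v.1).fun_add (hφy v.1 v.2 hv)).congr_deriv (by ring))
      (hIe.mono fun v hv => (hφt v.1 v.2 hv).const_add v.1)
      (((hcα _ _ (hΩI p hp)).pow 2).sub ((hcβ _ _ (hΩI p hp)).pow 2))
      (((hcf _ _ (hΩI p hp)).pow 2).neg.div_const 2)
    exact h.prodMk hasStrictFDerivAt_snd
  -- The differential is a shear with nonzero factor α² - β², so the map is locally open.
  constructor
  · refine isOpen_iff_mem_nhds.2 ?_
    rintro _ ⟨p, hp, rfl⟩
    have h := hx p hp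
    rw [← coe_shearEquiv _ _ (hpos p hp).ne'] at h
    rw [← h.map_nhds_eq_of_equiv]
    exact image_mem_map (hΩ.mem_nhds hp)
  · rintro x t ⟨⟨y, t₀⟩, hp, hxy⟩
    obtain ⟨hxe, rfl⟩ : y + φ y t₀ = x ∧ t₀ = t := by simpa using hxy
    have ht : t₀ ∈ I := hΩI _ hp
    have hyx : xhat x t₀ = y := hxe ▸ hinv _ hp
    obtain ⟨c, hc⟩ : ∃ c, c = α y t₀ ^ 2 - β y t₀ ^ 2 := ⟨_, rfl⟩
    have hc0 : 0 < c := hc ▸ hpos _ hp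
    have hg : HasStrictFDerivAt (fun p : ℝ × ℝ => (xhat p.1 p.2, p.2))
        ((shearEquiv c (-f y t₀ ^ 2 / 2) hc0.ne').symm : (ℝ × ℝ) →L[ℝ] (ℝ × ℝ)) (x, t₀) := by
      have h : HasStrictFDerivAt (fun p : ℝ × ℝ => (p.1 + φ p.1 p.2, p.2))
          (shearEquiv c (-f y t₀ ^ 2 / 2) hc0.ne' : (ℝ × ℝ) →L[ℝ] (ℝ × ℝ)) (y, t₀) := by
        rw [coe_shearEquiv, hc]
        exact hx (y, t₀) hp
      -- The given inverse on the open set Ω is in particular a local left inverse, so it inherits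
      -- the inverse derivative.
      have h' := h.to_local_left_inverse (g := fun p : ℝ × ℝ => (xhat p.1 p.2, p.2)) (by
        filter_upwards [hΩ.mem_nhds hp] with p hp'
        rw [hinv p hp'])
      simpa only [hxe] using h'
    have hg1 : HasFDerivAt (fun p : ℝ × ℝ => xhat p.1 p.2)
        (c⁻¹ • ContinuousLinearMap.fst ℝ ℝ ℝ +
          (-(c⁻¹ * (-f y t₀ ^ 2 / 2))) • ContinuousLinearMap.snd ℝ ℝ ℝ) (x, t₀) := by
      have h := hg.hasFDerivAt
      rw [coe_shearEquiv_symm] at h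
      exact h.fst
    have hgx : HasDerivAt (fun x' => xhat x' t₀) c⁻¹ x := by
      have := hg1.comp_hasDerivAt x ((hasDerivAt_id x).prodMk (hasDerivAt_const x t₀))
      refine this.congr_deriv ?_
      simp
    have hgt : HasDerivAt (fun t' => xhat x t') (c⁻¹ * (f y t₀ ^ 2 / 2)) t₀ := by
      have := hg1.comp_hasDerivAt t₀ ((hasDerivAt_const t₀ x).prodMk (hasDerivAt_id t₀))
      refine this.congr_deriv ?_
      simp
      ring
    -- The spatial derivative of 1/q̂ is kept opaque: it enters q_t and (u²q)_x/2 through the same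
    -- term.
    obtain ⟨cy, hcy⟩ : ∃ cy, cy = 2 * α y t₀ * a y t₀ - 2 * β y t₀ * b y t₀ := ⟨_, rfl⟩
    have hIe : ∀ᶠ v : ℝ × ℝ in 𝓝 (y, t₀), v.2 ∈ I := continuousAt_snd.eventually (hI.mem_nhds ht)
    have hq1 : HasFDerivAt (fun p : ℝ × ℝ => α p.1 p.2 ^ 2 - β p.1 p.2 ^ 2)
        (cy • ContinuousLinearMap.fst ℝ ℝ ℝ +
          (-(2 * α y t₀ * β y t₀ * f y t₀)) • ContinuousLinearMap.snd ℝ ℝ ℝ) (y, t₀) := by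
      have h := hasStrictFDerivAt_of_partials (p := (y, t₀))
        (F := fun y t => α y t ^ 2 - β y t ^ 2)
        (F₁ := fun y t => 2 * α y t * a y t - 2 * β y t * b y t)
        (F₂ := fun y t => -(2 * α y t * β y t * f y t))
        (hIe.mono fun v hv => (((hαy v.1 v.2 hv).fun_pow 2).fun_sub
          ((hβy v.1 v.2 hv).fun_pow 2)).congr_deriv (by norm_num))
        (hIe.mono fun v hv => (((hαt v.1 v.2 hv).fun_pow 2).fun_sub
          ((hβt v.1 v.2 hv).fun_pow 2)).congr_deriv (by norm_num; ring))
        ((((hcα y t₀ ht).const_mul 2).mul (hca y t₀ ht)).sub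
          (((hcβ y t₀ ht).const_mul 2).mul (hcb y t₀ ht)))
        ((((hcα y t₀ ht).const_mul 2).mul (hcβ y t₀ ht)).mul (hcf y t₀ ht)).neg
      rw [hcy]
      exact h.hasFDerivAt
    have hux : HasDerivAt (fun x' => u x' t₀) (2 * α y t₀ * β y t₀ * c⁻¹) x := by
      have h' := HasDerivAt.comp_of_eq x (hfy y t₀ ht) hgx hyx.symm
      exact h'.congr_of_eventuallyEq (Eventually.of_forall fun x' => hu x' t₀)
    have hqx : HasDerivAt (fun x' => q x' t₀) (-(cy * c⁻¹) / c ^ 2) x := by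
      have h' := (hq1.comp_hasDerivAt_of_eq x (hgx.prodMk (hasDerivAt_const x t₀))
        (by rw [hyx])).fun_inv (by simpa [hyx, ← hc] using hc0.ne')
      refine (h'.congr_deriv ?_).congr_of_eventuallyEq (Eventually.of_forall fun x' => ?_)
      · simp [hyx, ← hc]
      · simp [hq, one_div]
    have hqt : HasDerivAt (fun t' => q x t')
        (-(cy * (c⁻¹ * (f y t₀ ^ 2 / 2)) - 2 * α y t₀ * β y t₀ * f y t₀) / c ^ 2) t₀ := by
      have h' := (hq1.comp_hasDerivAt_of_eq t₀ (hgt.prodMk (hasDerivAt_id t₀))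
        (by rw [hyx]; rfl)).fun_inv (by simpa [hyx, ← hc] using hc0.ne')
      refine (h'.congr_deriv ?_).congr_of_eventuallyEq (Eventually.of_forall fun t' => ?_)
      · simp [hyx, ← hc]
        ring
      · simp [hq, one_div]
    have hqv : q x t₀ = 1 / c := by
      rw [hq, hyx, hc]
    have huv : u x t₀ = f y t₀ := by
      rw [hu, hyx]
    refine ⟨hux.differentiableAt, hqx.differentiableAt, hqt.differentiableAt, ?_, ?_⟩
    · rw [hqv, hux.deriv]
      have : 1 + (2 * α y t₀ * β y t₀ * c⁻¹) ^ 2 = (1 / c) ^ 2 := by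
        have h1 : c ^ 2 + (2 * α y t₀ * β y t₀) ^ 2 = 1 := by
          have : c ^ 2 + (2 * α y t₀ * β y t₀) ^ 2 = (α y t₀ ^ 2 + β y t₀ ^ 2) ^ 2 := by
            rw [hc]
            ring
          rw [this, hαβ y t₀ ht, one_pow]
        field_simp
        linear_combination h1
      rw [this, Real.sqrt_sq (by positivity)]
    · rw [hqt.deriv, ((hux.fun_pow 2).fun_mul hqx).deriv, hqv, huv]
      field_simp
      ring

end ShortPulse

open ShortPulse in
theorem corollary3p3 (D : ShortPulse.SpectralData)
    (I : Set ℝ) (hI : IsOpen I)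
    (M : ℝ → ℝ → ℂ → ShortPulse.Mat)
    (hM : D.IsUniqueRHFamily I M)
    (hexp : ShortPulse.HasExpansions I M)
    -- a region of the `(y, t)`-plane on which `q̂` is finite and positive and
    -- `y ↦ x(y, t)` is invertible, with inverse `x ↦ xhat x t`
    (Ω : Set (ℝ × ℝ)) (hΩ : IsOpen Ω) (hΩI : ∀ p ∈ Ω, p.2 ∈ I)
    (hpos : ∀ p ∈ Ω, 0 < ShortPulse.alpha M p.1 p.2 ^ 2 - ShortPulse.beta M p.1 p.2 ^ 2)
    (xhat : ℝ → ℝ → ℝ)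
    (hinv : ∀ p ∈ Ω, xhat (ShortPulse.xOf M p.1 p.2) p.2 = p.1)
    (u q : ℝ → ℝ → ℝ)
    (hu : ∀ x t, u x t = ShortPulse.uHat M (xhat x t) t)
    (hq : ∀ x t, q x t = ShortPulse.qHat M (xhat x t) t) :
    -- the matrices at `k = 0` have the forms that define `α, β, f₁, f₂`
    (∀ y : ℝ, ∀ t ∈ I,
      ShortPulse.atZero (M y t) =
        !![(ShortPulse.alpha M y t : ℂ), (ShortPulse.beta M y t : ℂ);
          -(ShortPulse.beta M y t : ℂ), (ShortPulse.alpha M y t : ℂ)] ∧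
      ShortPulse.slopeAtZero (M y t) =
        !![(ShortPulse.f1 M y t : ℂ), (ShortPulse.f2 M y t : ℂ);
          (ShortPulse.f2 M y t : ℂ), -(ShortPulse.f1 M y t : ℂ)]) ∧
    -- the short pulse equation in conservation law form, at each point `(x, t)` of the
    -- (open) image of the region
    IsOpen ((fun p : ℝ × ℝ => (ShortPulse.xOf M p.1 p.2, p.2)) '' Ω) ∧
    ∀ x t : ℝ, (x, t) ∈ (fun p : ℝ × ℝ => (ShortPulse.xOf M p.1 p.2, p.2)) '' Ω →
      DifferentiableAt ℝ (fun x' => u x' t) x ∧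
      DifferentiableAt ℝ (fun x' => q x' t) x ∧
      DifferentiableAt ℝ (fun t' => q x t') t ∧
      q x t = Real.sqrt (1 + deriv (fun x' => u x' t) x ^ 2) ∧
      deriv (fun t' => q x t') t = 1 / 2 * deriv (fun x' => u x' t ^ 2 * q x' t) x := by
  obtain ⟨a, b, hac, hbc, hab⟩ := hexp.exists_hasDerivAt_alpha_beta_space hM hI
  have hnhds : ∀ y : ℝ, ∀ t ∈ I, Set.univ ×ˢ I ∈ 𝓝 (y, t) := fun y t ht =>
    (isOpen_univ.prod hI).mem_nhds ⟨trivial, ht⟩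
  exact ⟨fun y t ht => ⟨hexp.atZero_eq hM y ht, hexp.slopeAtZero_eq hM y ht⟩,
    shortPulse_of_profiles (α := alpha M) (β := beta M) (φ := f1 M) (f := f2 M)
      (a := fun y t => a (y, t)) (b := fun y t => b (y, t)) hI
      (fun y t ht => (hexp.continuousAt_profiles hM hI y ht).1)
      (fun y t ht => (hexp.continuousAt_profiles hM hI y ht).2.1)
      (fun y t ht => (hexp.continuousAt_profiles hM hI y ht).2.2)
      (fun y t ht => hac.continuousAt (hnhds y t ht))
      (fun y t ht => hbc.continuousAt (hnhds y t ht))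
      (fun y t ht => hexp.alpha_sq_add_beta_sq hM y ht)
      (fun y t ht => (hab y t ht).1) (fun y t ht => (hab y t ht).2)
      (fun y t ht => (hexp.hasDerivAt_alpha_beta_time hM hI y ht).1)
      (fun y t ht => (hexp.hasDerivAt_alpha_beta_time hM hI y ht).2)
      (fun y t ht => (hexp.hasDerivAt_f1_f2_space hM hI y ht).1)
      (fun y t ht => hexp.hasDerivAt_f1_time hM hI y ht)
      (fun y t ht => (hexp.hasDerivAt_f1_f2_space hM hI y ht).2)
      hΩ hΩI hpos hinv hu hq⟩
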